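/- Let $1\le k\le d$ be integers. Let $\mathbb T^d=\mathbb R^d/\mathbb Z^d$ be the flat torus with the toroidal metric $\rho(x,y)=\min_{\Delta\in\mathbb Z^d}\|x-y+\Delta\|$ and the uniform probability measure. For $n>0$ let $\mathcal P_n=\{X_1,\dots,X_N\}$ be the homogeneous Poisson process on $\mathbb T^d$ with intensity $n$: $X_1,X_2,\dots$ are i.i.d. uniform on $\mathbb T^d$, and $N\sim\mathrm{Poisson}(n)$ is independent of them. Let $\rho_n(x)=\min_{p\in\mathcal P_n}\rho(x,p)$ be its distance function, and let $r_{\max}=r_{\mathrm{conv}}/3=1/6$, where $r_{\mathrm{conv}}=1/2$ is the radius of convexity of $\mathbb T^d$. A point $c\in\mathbb T^d$ with $\rho_n(c)\le r_{\max}$ is a critical point of $\rho_n$ of index $k$ if there is a set $\mathcal Y\subset\mathcal P_n$ of $k+1$ points such that $\rho(c,y)=\rho_n(c)$ for all $y\in\mathcal Y$ and $\rho(c,p)>\rho_n(c)$ for all $p\in\mathcal P_n\setminus\mathcal Y$, and such that, in the chart $v\mapsto c+v \bmod \mathbb Z^d$ of the ball of radius $r_{\mathrm{conv}}$ around $c$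 by the ball of the same radius around $0$ in $\mathbb R^d$, the points of $\mathcal Y$ are affinely independent and $c$ lies in the open $k$-simplex that they span. Let $\hat C_k(r)$ be the number of critical points $c$ of index $k$ with $\rho_n(c)\in(r,r_{\max}]$. Let $\omega_d$ be the volume of the unit ball in $\mathbb R^d$, and let $$\tilde D_k=\frac{1}{\omega_d^k\,(k+1)!}\cdot dk\cdot\mathrm{vol}\bigl\{(y_1,\dots,y_k)\in(\mathbb R^d)^k:\ C(0,\mathbf y)\in\Delta(0,\mathbf y),\ R(0,\mathbf y)\le 1\bigr\},\qquad D_k=\frac{\tilde D_k\,(k-1)!}{d},$$ where $0,y_1,\dots,y_k$ are required to be affinely independent, $\Delta(0,\mathbf y)$ is the open $k$-simplex that they span, and $C(0,\mathbf y)$ and $R(0,\mathbf y)$ are its circumcentre and circumradius. (Thus $D_k$ depends only on $k$ and $d$.) Let $r=r(n)\ge 0$ and let $\Lambda=\omega_d\,n\,r^d$. Then $\hat C_k(r)$ is finite and has finite expectation. Suppose that $\Lambda=\log n+(k-1)\log\log n+w(n)$ for all large $n$. Then $$\lim_{n\to\infty}\mathbb E\bigl[\hat C_k(r)\bigr]=\begin{cases}\infty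 & \text{if } w(n)\to-\infty,\\[2pt] \dfrac{D_k}{(k-1)!}\,e^{-a} & \text{if } w(n)\to a\in(-\infty,\infty),\\[2pt] 0 & \text{if } w(n)\to+\infty.\end{cases}$$ -/

import Mathlib

open MeasureTheory ProbabilityTheory Filter Topology
open scoped NNReal

noncomputable section

namespace TorusPoisson

/-- The volume `ω_d` of the unit ball in `ℝ^d`. -/
def ballVolume (d : ℕ) : ℝ :=
  volume.real (Metric.ball (0 : EuclideanSpace ℝ (Fin d)) 1)

/-! ### The flat torus `𝕋^d = ℝ^d / ℤ^d` -/

/-- The quotient map `ℝ^d → 𝕋^d`. The torus is `UnitAddTorus (Fin d) = (Fin d → ℝ / ℤ)`, with its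
uniform probability measure `volume`. -/
def proj {d : ℕ} (v : EuclideanSpace ℝ (Fin d)) : UnitAddTorus (Fin d) :=
  fun i => (v i : UnitAddCircle)

/-- The toroidal metric `ρ`; see `isLeast_torusDist`. (The torus is a `Pi` type, so its `dist` in
Mathlib is a sup distance and is not used here.) -/
def torusDist {d : ℕ} (x y : UnitAddTorus (Fin d)) : ℝ :=
  Real.sqrt (∑ i, dist (x i) (y i) ^ 2)

/-- The toroidal metric is `ρ(x, y) = min_{Δ ∈ ℤ^d} ‖x - y + Δ‖`. -/
theorem isLeast_torusDist {d : ℕ} (v w : EuclideanSpace ℝ (Fin d)) :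
    IsLeast (Set.range fun Δ : Fin d → ℤ => ‖v - w + WithLp.toLp 2 (fun i => (Δ i : ℝ))‖)
      (torusDist (proj v) (proj w)) := by
  have key : ∀ i, dist (proj v i) (proj w i) = |v i - w i - round (v i - w i)| := by
    intro i
    rw [dist_eq_norm]
    simp only [proj]
    rw [← AddCircle.coe_sub, UnitAddCircle.norm_eq]
  constructor
  · refine ⟨fun i => - round (v i - w i), ?_⟩
    simp only [EuclideanSpace.norm_eq, torusDist, key]
    congr 1
    refine Finset.sum_congr rfl fun i _ => ?_
    simp [sub_eq_add_neg]
  · rintro _ ⟨Δ, rfl⟩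
    simp only [EuclideanSpace.norm_eq, torusDist, key]
    refine Real.sqrt_le_sqrt (Finset.sum_le_sum fun i _ => ?_)
    refine pow_le_pow_left₀ (abs_nonneg _) ?_ 2
    have h := round_le (v i - w i) (-Δ i)
    simpa using h

/-- The distance function `ρ_P(x) = min_{p ∈ P} ρ(x, p)` of a finite set `P` in the torus. -/
def torusDistFn {d : ℕ} (P : Set (UnitAddTorus (Fin d))) (x : UnitAddTorus (Fin d)) : ℝ :=
  sInf (torusDist x '' P)

/-- The radius of convexity of the flat torus. -/
def rConv : ℝ := 1 / 2

/-- `r_max = r_conv / 3`. -/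
def rMax : ℝ := rConv / 3

/-! ### Critical points of the distance function -/

/-- The point `c` is a critical point, of index `k ≥ 1`, of the distance function of a finite set
`P` in `ℝ^d`: there are `k + 1` affinely independent points of `P` (the vertices of `s`), all of
them nearest to `c` among the points of `P`, the other points of `P` being strictly farther, with
`c` in the open `k`-simplex spanned by them. -/
def IsCriticalPoint {d : ℕ} (P : Set (EuclideanSpace ℝ (Fin d))) (k : ℕ)
    (c : EuclideanSpace ℝ (Fin d)) : Prop :=
  ∃ s : Affine.Simplex ℝ (EuclideanSpace ℝ (Fin d)) k,
    Set.range s.points ⊆ P ∧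
    (∀ i, dist c (s.points i) = Metric.infDist c P) ∧
    (∀ p ∈ P, p ∉ Set.range s.points → Metric.infDist c P < dist c p) ∧
    c ∈ s.interior

/-- The points of `P` in the ball of radius `r_conv` around `c`, seen in the chart
`v ↦ c + proj v` of that ball, which is centred at `c` and is a local isometry. -/
def localLift {d : ℕ} (P : Set (UnitAddTorus (Fin d))) (c : UnitAddTorus (Fin d)) :
    Set (EuclideanSpace ℝ (Fin d)) :=
  {v | ‖v‖ < rConv ∧ c + proj v ∈ P}

/-- The critical points of index `k` of the distance function of `P` in the torus whose value lies
in `(r, r_max]`. At such values, being critical is defined through the chart around `c`. -/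
def remainingCriticalPoints {d : ℕ} (P : Set (UnitAddTorus (Fin d))) (k : ℕ) (r : ℝ) :
    Set (UnitAddTorus (Fin d)) :=
  {c | IsCriticalPoint (localLift P c) k 0 ∧ r < torusDistFn P c ∧ torusDistFn P c ≤ rMax}

/-- `Ĉ_k(r)`, the number of critical points of index `k` with value in `(r, r_max]`. -/
def remainingCount {d : ℕ} (P : Set (UnitAddTorus (Fin d))) (k : ℕ) (r : ℝ) : ℕ :=
  (remainingCriticalPoints P k r).ncard

/-! ### The Poisson process -/

/-- `X_0, X_1, …` are i.i.d. uniform points of the torus, and `N` is a Poisson variable with mean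
`n` that is independent of them. -/
structure IsPoissonSample {Ω : Type*} [MeasurableSpace Ω] (μ : Measure Ω) {d : ℕ} (n : ℝ≥0)
    (X : ℕ → Ω → UnitAddTorus (Fin d)) (N : Ω → ℕ) : Prop where
  measurable_points : ∀ j, Measurable (X j)
  measurable_count : Measurable N
  uniform : ∀ j, μ.map (X j) = volume
  indep_points : iIndepFun X μ
  poisson : μ.map N = poissonMeasure n
  indep_count : IndepFun (fun ω j => X j ω) N μ

/-- The Poisson process: the first `N` of the points `X_0, X_1, …`. -/
def pointSet {Ω : Type*} {d : ℕ} (X : ℕ → Ω → UnitAddTorus (Fin d)) (N : Ω → ℕ) (ω : Ω) :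
    Set (UnitAddTorus (Fin d)) :=
  (fun j => X j ω) '' Set.Iio (N ω)

/-! ### The constant `D_k` -/

/-- The set of all `(y_1, …, y_k)` in `(ℝ^d)^k` such that `0, y_1, …, y_k` are affinely independent,
their circumcentre lies in the open simplex that they span, and their circumradius is at most `1`.
Its indicator is `h_1(0, y)`. -/
def centredTuples (d k : ℕ) : Set (Fin k → EuclideanSpace ℝ (Fin d)) :=
  {y | ∃ s : Affine.Simplex ℝ (EuclideanSpace ℝ (Fin d)) k,
    s.points = Fin.cons 0 y ∧ s.circumcenter ∈ s.interior ∧ s.circumradius ≤ 1}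

/-- `D̃_k = 1 / (ω_d^k (k + 1)!)` times the integral of the indicator `h` over the configurations
`(0, y_1, …, y_k)` of circumradius `τ = 1`, against the angular part `J(1, ·)` of Lebesgue measure
on `(ℝ^d)^k`. As Lebesgue measure is `τ^(d k - 1) dτ` times this angular part, and `h` does not
depend on `τ`, the angular integral is `d k` times the volume of the part `τ ≤ 1` of `{h = 1}`
(as in Mathlib's `MeasureTheory.Measure.toSphere`). -/
def constDTilde (d k : ℕ) : ℝ :=
  1 / (ballVolume d ^ k * (k + 1).factorial) * (d * k * volume.real (centredTuples d k))

/-- `D_k = D̃_k (k - 1)! / d`. -/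
def constD (d k : ℕ) : ℝ :=
  constDTilde d k * (k - 1).factorial / d

end TorusPoisson

end

/-! Every critical point of index `k` comes from exactly `(k + 1)!` ordered `(k + 1)`-tuples of
sample points: their circumcentre lies in the open simplex that they span, and no other sample point
lies in the closed circumball (`ncard_criticalTuples`). If the circumball has volume `V`, each of
the other points misses it with probability `1 - V`. Averaging over the Poisson count gives `n ^ (k
+ 1) * exp (-n V)`, integrated over the admissible tuples (`tsum_poisson_mul_tupleProb`).

Admissible radii are at most `1/6`, so all of this happens where the torus looks Euclidean.
Translation invariance removes one point and leaves Lebesgue measure on `(ℝ^d)^k`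
(`lintegral_lift_sub`). The circumcentre scales linearly, so the law of `V` on centred tuples has a
density proportional to `s ^ (k - 1)` (`map_circumVolume`). The expectation is therefore the
positive part of `D_k / (k - 1)!` times `n Γ(k, Λ) - n Γ(k, n ω_d r_max ^ d)`
(`IsPoissonSample.integral_remainingCount`).

The second term tends to `0`. Since `Γ(k, u) ~ u ^ (k - 1) exp (-u)`, the threshold `Λ = log n + (k
- 1) log log n + w` makes the first term converge to `exp (-a)` when `w → a`
(`tendsto_mul_upperGamma`). For `w → ±∞`, monotonicity of `Γ(k, ·)` allows comparison with constant
`w`; divergence also needs `D_k > 0`, which holds because `k ≤ d`. -/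

noncomputable section

namespace TorusPoisson

/-! ### Circumcentres through the Gram matrix -/

section Circumcentre

variable {k : ℕ} {V : Type*} [NormedAddCommGroup V] [InnerProductSpace ℝ V]

/-- The coordinates, with respect to `z`, of the circumcentre of `0, z_1, …, z_k`. -/
def circumWeights (z : Fin k → V) : Fin k → ℝ :=
  (Matrix.gram ℝ z)⁻¹.mulVec fun i => ‖z i‖ ^ 2 / 2

/-- The circumcentre of `0, z_1, …, z_k`. -/
def centre (z : Fin k → V) : V := ∑ i, circumWeights z i • z i

/-- The points `0, z_1, …, z_k` are affinely independent and their circumcentre lies in the open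
simplex that they span. -/
def IsCentred (z : Fin k → V) : Prop :=
  LinearIndependent ℝ z ∧ (∀ i, 0 < circumWeights z i) ∧ ∑ i, circumWeights z i < 1

/-- The equations on the right are the linear system `G t = (‖z_i‖² / 2)_i` for the Gram matrix `G`,
which is invertible because `z` is linearly independent. -/
theorem eq_circumWeights_iff {z : Fin k → V} (hz : LinearIndependent ℝ z) (t : Fin k → ℝ) :
    t = circumWeights z ↔ ∀ i, 2 * inner ℝ (∑ j, t j • z j) (z i) = ‖z i‖ ^ 2 := by
  have hdet : IsUnit (Matrix.gram ℝ z).det :=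
    isUnit_iff_ne_zero.2 (Matrix.det_gram_ne_zero_iff_linearIndependent.2 hz)
  have key : ∀ i, inner ℝ (∑ j, t j • z j) (z i) = (Matrix.gram ℝ z).mulVec t i := by
    intro i
    simp only [Matrix.mulVec, dotProduct, Matrix.gram_apply, sum_inner, inner_smul_left]
    refine Finset.sum_congr rfl fun j _ => ?_
    rw [real_inner_comm]
    simp [mul_comm]
  have h2 : t = circumWeights z ↔ (Matrix.gram ℝ z).mulVec t = fun i => ‖z i‖ ^ 2 / 2 := by
    constructor
    · rintro rfl
      rw [circumWeights, Matrix.mulVec_mulVec, Matrix.mul_nonsing_inv _ hdet, Matrix.one_mulVec]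
    · intro h
      rw [circumWeights, ← h, Matrix.mulVec_mulVec, Matrix.nonsing_inv_mul _ hdet,
        Matrix.one_mulVec]
  rw [h2, funext_iff]
  refine forall_congr' fun i => ?_
  rw [key]
  constructor <;> intro h <;> linarith

/-- This removes the matrix inverse: being centred can be checked by exhibiting weights and
verifying the equations of equidistance. Scaling, the explicit example and the link with simplices
all go through it. -/
theorem isCentred_and_eq_centre_iff (z : Fin k → V) (c : V) :
    IsCentred z ∧ c = centre z ↔ LinearIndependent ℝ z ∧ ∃ t : Fin k → ℝ, (∀ i, 0 < t i) ∧
      ∑ i, t i < 1 ∧ c = ∑ i, t i • z i ∧ ∀ i, 2 * inner ℝ c (z i) = ‖z i‖ ^ 2 := by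
  constructor
  · rintro ⟨⟨hz, h0, h1⟩, hc⟩
    refine ⟨hz, circumWeights z, h0, h1, hc, ?_⟩
    rw [hc]
    exact (eq_circumWeights_iff hz _).1 rfl
  · rintro ⟨hz, t, h0, h1, hc, hi⟩
    have ht : t = circumWeights z := (eq_circumWeights_iff hz t).2 (by rwa [← hc])
    subst ht
    exact ⟨⟨hz, h0, h1⟩, hc⟩

theorem norm_sub_eq_norm_iff (c v : V) : ‖c - v‖ = ‖c‖ ↔ 2 * inner ℝ c v = ‖v‖ ^ 2 := by
  rw [← sq_eq_sq₀ (norm_nonneg _) (norm_nonneg _), norm_sub_sq_real]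
  constructor <;> intro h <;> linarith

theorem IsCentred.norm_centre_sub {z : Fin k → V} (hz : IsCentred z) (i : Fin k) :
    ‖centre z - z i‖ = ‖centre z‖ := by
  obtain ⟨-, t, -, -, -, h⟩ := (isCentred_and_eq_centre_iff z _).1 ⟨hz, rfl⟩
  exact (norm_sub_eq_norm_iff _ _).2 (h i)

theorem IsCentred.norm_le {z : Fin k → V} (hz : IsCentred z) (i : Fin k) :
    ‖z i‖ ≤ 2 * ‖centre z‖ := by
  have h := hz.norm_centre_sub i
  have : ‖z i‖ ≤ ‖centre z‖ + ‖centre z - z i‖ := by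
    simpa using norm_sub_le (centre z) (centre z - z i)
  linarith

/-- The same weights work after scaling, since both sides of the equations are quadratic in the
scale. -/
theorem isCentred_smul_and {z : Fin k → V} (hz : IsCentred z) {a : ℝ} (ha : 0 < a) :
    IsCentred (a • z) ∧ a • centre z = centre (a • z) := by
  obtain ⟨hl, t, h0, h1, hc, h⟩ := (isCentred_and_eq_centre_iff z _).1 ⟨hz, rfl⟩
  refine (isCentred_and_eq_centre_iff _ _).2 ⟨?_, t, h0, h1, ?_, fun i => ?_⟩
  · exact hl.units_smul (fun _ => Units.mk0 a ha.ne')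
  · rw [hc, Finset.smul_sum]
    exact Finset.sum_congr rfl fun i _ => smul_comm _ _ _
  · rw [Pi.smul_apply, inner_smul_left, inner_smul_right, norm_smul, mul_pow, ← h i]
    simp
    ring

theorem exists_simplex_iff (hk : 1 ≤ k) (p : Fin (k + 1) → V) (c : V) :
    (∃ s : Affine.Simplex ℝ V k, s.points = p ∧ c ∈ s.interior ∧
      ∀ i, dist c (p i) = dist c (p 0)) ↔
    IsCentred (fun i : Fin k => p i.succ - p 0) ∧ c - p 0 = centre fun i => p i.succ - p 0 := by
  rw [isCentred_and_eq_centre_iff]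
  have hind : AffineIndependent ℝ p ↔ LinearIndependent ℝ fun i : Fin k => p i.succ - p 0 := by
    rw [affineIndependent_iff_linearIndependent_vsub ℝ p 0]
    exact (linearIndependent_equiv' (finSuccAboveEquiv (0 : Fin (k + 1))) (by
      ext i; simp [finSuccAboveEquiv])).symm
  have hdist : (∀ i, dist c (p i) = dist c (p 0)) ↔
      ∀ i : Fin k, 2 * inner ℝ (c - p 0) (p i.succ - p 0) = ‖p i.succ - p 0‖ ^ 2 := by
    rw [Fin.forall_fin_succ]
    simp only [true_and]
    refine forall_congr' fun i => ?_
    rw [← norm_sub_eq_norm_iff, dist_eq_norm, dist_eq_norm, sub_sub_sub_cancel_right]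
  have hcomb : ∀ w : Fin (k + 1) → ℝ, ∑ i, w i = 1 →
      Finset.univ.affineCombination ℝ p w - p 0 = ∑ i : Fin k, w i.succ • (p i.succ - p 0) := by
    intro w hw
    rw [Finset.affineCombination_eq_linear_combination _ _ _ hw]
    simp only [smul_sub, Finset.sum_sub_distrib, ← Finset.sum_smul]
    rw [Fin.sum_univ_succ] at hw ⊢
    have : w 0 = 1 - ∑ i : Fin k, w i.succ := by linarith
    rw [this, sub_smul, one_smul]
    abel
  rw [← hind, ← hdist]
  constructor
  · rintro ⟨s, rfl, hc, hd⟩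
    refine ⟨s.independent, ?_⟩
    obtain ⟨w, hw, hw1, hwc⟩ := hc
    refine ⟨fun i => w i.succ, fun i => (hw1 _).1, ?_, ?_, hd⟩
    · rw [Fin.sum_univ_succ] at hw
      linarith [(hw1 0).1]
    · rw [← hwc, hcomb w hw]
  · rintro ⟨hp, t, h0, h1, hc, hd⟩
    refine ⟨⟨p, hp⟩, rfl, ?_, hd⟩
    have hsum : ∑ i, (Fin.cons (1 - ∑ i, t i) t : Fin (k + 1) → ℝ) i = 1 := by
      rw [Fin.sum_univ_succ]; simp
    have : c = Finset.univ.affineCombination ℝ p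
        (Fin.cons (1 - ∑ i, t i) t : Fin (k + 1) → ℝ) := by
      rw [← sub_left_inj (a := p 0), hcomb _ hsum, hc]
      simp
    rw [this]
    refine (Affine.Simplex.affineCombination_mem_interior_iff (s := ⟨p, hp⟩) hsum).2 ?_
    rw [Fin.forall_fin_succ]
    have hle : ∀ i, t i ≤ ∑ j, t j := fun i =>
      Finset.single_le_sum (fun j _ => (h0 j).le) (Finset.mem_univ i)
    -- The weight of vertex `0` is `1 - ∑ t`, and it is below `1` only because there is at least one
    -- other vertex.
    have hpos : 0 < ∑ j, t j := (h0 ⟨0, hk⟩).trans_le (hle _)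
    refine ⟨⟨by simpa using h1, by simpa using hpos⟩, fun i => ⟨by simpa using h0 i, ?_⟩⟩
    simpa using (hle i).trans_lt h1

end Circumcentre

theorem centredTuples_eq {d k : ℕ} (hk : 1 ≤ k) :
    centredTuples d k = {z | IsCentred z ∧ ‖centre z‖ ≤ 1} := by
  ext z
  constructor
  · rintro ⟨s, hs, hc, hr⟩
    have h := (exists_simplex_iff hk (Fin.cons 0 z) s.circumcenter).1 ⟨s, hs, hc, by
      rw [← hs]
      intro i
      rw [dist_comm, s.dist_circumcenter_eq_circumradius, dist_comm,
        s.dist_circumcenter_eq_circumradius]⟩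
    simp only [Fin.cons_succ, Fin.cons_zero, sub_zero] at h
    refine ⟨h.1, ?_⟩
    rw [← h.2, ← dist_zero_left]
    have := s.dist_circumcenter_eq_circumradius 0
    rw [hs, Fin.cons_zero] at this
    rwa [this]
  · rintro ⟨hz, hr⟩
    obtain ⟨s, hs, hc, hd⟩ := (exists_simplex_iff hk (Fin.cons 0 z) (centre z)).2 (by
      simpa using hz)
    have := s.eq_circumcenter_of_dist_eq (p := centre z) (r := ‖centre z‖)
      (s.setInterior_subset_affineSpan hc) (by
        intro i
        rw [hs, dist_comm, hd]
        simp)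
    have h2 := s.eq_circumradius_of_dist_eq (p := centre z) (r := ‖centre z‖)
      (s.setInterior_subset_affineSpan hc) (by
        intro i
        rw [hs, dist_comm, hd]
        simp)
    exact ⟨s, hs, by rwa [← this], by rwa [← h2]⟩

/-! ### Representatives of points of the torus in the unit cube -/

section Lift

variable {d : ℕ}

/-- The representative of a point of the torus in the cube `(-1/2, 1/2]^d`. -/
def lift (u : UnitAddTorus (Fin d)) : EuclideanSpace ℝ (Fin d) :=
  WithLp.toLp 2 fun i => (AddCircle.equivIoc (1 : ℝ) (-1 / 2) (u i) : ℝ)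

/-- The cube `(-1/2, 1/2]^d`. -/
def unitCube (d : ℕ) : Set (EuclideanSpace ℝ (Fin d)) :=
  {v | ∀ i, v i ∈ Set.Ioc (-1 / 2 : ℝ) (1 / 2)}

theorem proj_sub (v w : EuclideanSpace ℝ (Fin d)) : proj (v - w) = proj v - proj w := rfl

theorem proj_neg (v : EuclideanSpace ℝ (Fin d)) : proj (-v) = -proj v := rfl

theorem proj_lift (u : UnitAddTorus (Fin d)) : proj (lift u) = u := by
  funext i
  exact (AddCircle.equivIoc (1 : ℝ) (-1 / 2)).symm_apply_apply (u i)

theorem lift_proj_of_mem {v : EuclideanSpace ℝ (Fin d)} (hv : v ∈ unitCube d) :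
    lift (proj v) = v := by
  ext i
  have h := hv i
  simp only [lift, proj]
  rw [AddCircle.equivIoc_coe_eq]
  rwa [show (-1 / 2 + 1 : ℝ) = 1 / 2 by norm_num]

theorem mem_unitCube_of_norm_lt {v : EuclideanSpace ℝ (Fin d)} (hv : ‖v‖ < 1 / 2) :
    v ∈ unitCube d := by
  intro i
  have h := (PiLp.norm_apply_le v i).trans_lt hv
  rw [Real.norm_eq_abs, abs_lt] at h
  constructor <;> linarith [h.1, h.2]

theorem lift_proj {v : EuclideanSpace ℝ (Fin d)} (hv : ‖v‖ < 1 / 2) : lift (proj v) = v :=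
  lift_proj_of_mem (mem_unitCube_of_norm_lt hv)

theorem norm_lift (u : UnitAddTorus (Fin d)) : ‖lift u‖ = Real.sqrt (∑ i, ‖u i‖ ^ 2) := by
  rw [EuclideanSpace.norm_eq]
  congr 1
  refine Finset.sum_congr rfl fun i _ => ?_
  congr 1
  have h1 : ((lift u i : ℝ) : UnitAddCircle) = u i := congrFun (proj_lift u) i
  have h2 := (AddCircle.equivIoc (1 : ℝ) (-1 / 2) (u i)).2
  rw [← h1, Real.norm_eq_abs, eq_comm, AddCircle.norm_coe_eq_abs_iff]
  · have h3 : lift u i ∈ Set.Ioc (-1 / 2 : ℝ) (-1 / 2 + 1) := h2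
    rw [abs_le, abs_one]
    constructor <;> linarith [h3.1, h3.2]
  · exact one_ne_zero

theorem torusDist_eq (x y : UnitAddTorus (Fin d)) : torusDist x y = ‖lift (y - x)‖ := by
  rw [norm_lift, torusDist]
  simp only [dist_comm (x _), dist_eq_norm, Pi.sub_apply]

theorem torusDist_add_proj (c : UnitAddTorus (Fin d)) {v : EuclideanSpace ℝ (Fin d)}
    (hv : ‖v‖ < 1 / 2) : torusDist c (c + proj v) = ‖v‖ := by
  rw [torusDist_eq, add_sub_cancel_left, lift_proj hv]

theorem continuous_proj : Continuous (proj : EuclideanSpace ℝ (Fin d) → _) := by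
  unfold proj
  refine continuous_pi fun i => (AddCircle.continuous_mk' 1).comp ?_
  fun_prop

theorem measurable_torusDist {α : Type*} [MeasurableSpace α] {f g : α → UnitAddTorus (Fin d)}
    (hf : Measurable f) (hg : Measurable g) : Measurable fun a => torusDist (f a) (g a) := by
  unfold torusDist
  exact (Finset.measurable_sum _ fun i _ => (((measurable_pi_apply i).comp hf).dist
    ((measurable_pi_apply i).comp hg)).pow_const 2).sqrt

theorem continuous_torusDist_right (c : UnitAddTorus (Fin d)) : Continuous (torusDist c) := by
  unfold torusDist
  fun_prop

theorem measurable_lift : Measurable (lift : UnitAddTorus (Fin d) → _) := by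
  refine (MeasurableEquiv.toLp 2 (Fin d → ℝ)).measurable.comp (measurable_pi_lambda _ fun i => ?_)
  exact measurable_subtype_coe.comp
    ((AddCircle.measurableEquivIoc (1 : ℝ) (-1 / 2)).measurable.comp (measurable_pi_apply i))

theorem measurableSet_unitCube : MeasurableSet (unitCube d) := by
  unfold unitCube
  simp only [Set.ofPred_forall]
  refine MeasurableSet.iInter fun i => ?_
  exact (by fun_prop : Measurable fun v : EuclideanSpace ℝ (Fin d) => v i) measurableSet_Ioc

theorem measurePreserving_proj :
    MeasurePreserving (proj : EuclideanSpace ℝ (Fin d) → _)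
      (volume.restrict (unitCube d)) volume := by
  have h1 : MeasurePreserving (fun (x : Fin d → ℝ) i => (x i : UnitAddCircle))
      (Measure.pi fun _ => volume.restrict (Set.Ioc (-1 / 2 : ℝ) (-1 / 2 + 1)))
      (Measure.pi fun _ => volume) :=
    measurePreserving_pi _ _ fun i => AddCircle.measurePreserving_mk 1 _
  rw [← Measure.restrict_pi_pi] at h1
  have h2 : MeasurePreserving (WithLp.ofLp : EuclideanSpace ℝ (Fin d) → Fin d → ℝ)
      (volume.restrict (unitCube d)) (volume.restrict
        (Set.univ.pi fun _ => Set.Ioc (-1 / 2 : ℝ) (-1 / 2 + 1))) := by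
    have h := (PiLp.volume_preserving_ofLp (Fin d)).restrict_preimage
      (s := Set.univ.pi fun _ => Set.Ioc (-1 / 2 : ℝ) (-1 / 2 + 1))
      (MeasurableSet.univ_pi fun _ => measurableSet_Ioc)
    have e : unitCube d = WithLp.ofLp ⁻¹' Set.univ.pi fun _ : Fin d =>
        Set.Ioc (-1 / 2 : ℝ) (-1 / 2 + 1) := by
      ext v
      simp only [unitCube, Set.mem_ofPred_eq, Set.mem_preimage, Set.mem_pi, Set.mem_univ,
        true_implies]
      norm_num
    rwa [e]
  exact h1.comp h2

instance isProbabilityMeasure_unitAddCircle :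
    IsProbabilityMeasure (volume : Measure UnitAddCircle) :=
  ⟨UnitAddCircle.measure_univ⟩

instance isProbabilityMeasure_unitAddTorus :
    IsProbabilityMeasure (volume : Measure (UnitAddTorus (Fin d))) :=
  inferInstance

instance isAddRightInvariant_unitAddTorus :
    (volume : Measure (UnitAddTorus (Fin d))).IsAddRightInvariant :=
  inferInstance

instance isAddRightInvariant_tuples {k : ℕ} :
    (volume : Measure (Fin k → UnitAddTorus (Fin d))).IsAddRightInvariant :=
  Measure.pi.isAddRightInvariant _

instance nullSingletonClass_unitAddCircle :
    NullSingletonClass (volume : Measure UnitAddCircle) := by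
  constructor
  intro x
  rw [← Metric.closedBall_zero, AddCircle.volume_closedBall]
  simp

theorem nullSingletonClass_unitAddTorus (hd : 0 < d) :
    NullSingletonClass (volume : Measure (UnitAddTorus (Fin d))) :=
  Measure.pi_nullSingletonClass ⟨0, hd⟩

theorem ballVolume_pos (d : ℕ) : 0 < ballVolume d :=
  ENNReal.toReal_pos (Metric.measure_ball_pos _ _ one_pos).ne' measure_ball_lt_top.ne

/-- For `R < 1/2` the Euclidean ball fits in the unit cube, so the torus ball has the Euclidean
volume. -/
theorem volume_torusDist_le (c : UnitAddTorus (Fin d)) {R : ℝ} (h0 : 0 ≤ R) (h1 : R < 1 / 2) :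
    volume {p | torusDist c p ≤ R} = ENNReal.ofReal (ballVolume d * R ^ d) := by
  have hm : MeasurableSet {u : UnitAddTorus (Fin d) | ‖lift u‖ ≤ R} :=
    measurableSet_le measurable_lift.norm measurable_const
  have e1 : {p | torusDist c p ≤ R} = (fun p => p - c) ⁻¹' {u | ‖lift u‖ ≤ R} := by
    ext p; simp [torusDist_eq]
  rw [e1, (measurePreserving_sub_right volume c).measure_preimage hm.nullMeasurableSet,
    ← measurePreserving_proj.measure_preimage hm.nullMeasurableSet, Measure.restrict_apply
      (measurePreserving_proj.measurable hm)]
  have e2 : (proj ⁻¹' {u | ‖lift u‖ ≤ R} ∩ unitCube d) =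
      Metric.closedBall (0 : EuclideanSpace ℝ (Fin d)) R := by
    ext v
    simp only [Set.mem_inter_iff, Set.mem_preimage, Set.mem_ofPred_eq, mem_closedBall_zero_iff]
    constructor
    · rintro ⟨h, hv⟩
      rwa [lift_proj_of_mem hv] at h
    · intro h
      have hv := mem_unitCube_of_norm_lt (h.trans_lt h1)
      exact ⟨by rwa [lift_proj_of_mem hv], hv⟩
  rw [e2, Measure.addHaar_closedBall _ _ h0, finrank_euclideanSpace, Fintype.card_fin,
    mul_comm (ballVolume d), ENNReal.ofReal_mul (by positivity), ballVolume, ofReal_measureReal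
      measure_ball_lt_top.ne]

theorem volume_lt_torusDist (c : UnitAddTorus (Fin d)) {R : ℝ} (h0 : 0 ≤ R) (h1 : R < 1 / 2) :
    volume {p | R < torusDist c p} = ENNReal.ofReal (1 - ballVolume d * R ^ d) := by
  have hm : MeasurableSet {p : UnitAddTorus (Fin d) | torusDist c p ≤ R} :=
    measurableSet_le (continuous_torusDist_right c).measurable measurable_const
  have : {p | R < torusDist c p} = {p | torusDist c p ≤ R}ᶜ := by ext; simp
  rw [this, prob_compl_eq_one_sub hm, volume_torusDist_le c h0 h1, ← ENNReal.ofReal_one,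
    ENNReal.ofReal_sub]
  have := (ballVolume_pos d).le
  positivity

theorem ballVolume_mul_pow_le_one (c : UnitAddTorus (Fin d)) {R : ℝ} (h0 : 0 ≤ R)
    (h1 : R < 1 / 2) : ballVolume d * R ^ d ≤ 1 := by
  have h := prob_le_one (μ := volume) (s := {p | torusDist c p ≤ R})
  rwa [volume_torusDist_le c h0 h1, ENNReal.ofReal_le_one] at h

/-- Lebesgue measure on tuples of points of the torus, relative to one of them. -/
theorem lintegral_lift_sub {k : ℕ} (H : (Fin k → EuclideanSpace ℝ (Fin d)) → ENNReal)
    (hH : Measurable H) (hsupp : ∀ z, H z ≠ 0 → ∀ i, ‖z i‖ < 1 / 2) :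
    ∫⁻ x : Fin (k + 1) → UnitAddTorus (Fin d), H (fun i => lift (x i.succ - x 0)) =
      ∫⁻ z, H z := by
  have hml : Measurable fun u : Fin k → UnitAddTorus (Fin d) => fun i => lift (u i) :=
    measurable_pi_lambda _ fun i => measurable_lift.comp (measurable_pi_apply i)
  have h1 := (volume_preserving_piFinSuccAbove
    (fun _ : Fin (k + 1) => UnitAddTorus (Fin d)) 0).lintegral_comp
    (f := fun q => H (fun i => lift (q.2 i - q.1))) (by
      refine hH.comp (measurable_pi_lambda _ fun i => measurable_lift.comp ?_)
      fun_prop)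
  have e1 : ∫⁻ x : Fin (k + 1) → UnitAddTorus (Fin d), H (fun i => lift (x i.succ - x 0)) =
      ∫⁻ q : UnitAddTorus (Fin d) × (Fin k → UnitAddTorus (Fin d)),
        H (fun i => lift (q.2 i - q.1)) := by
    rw [← h1]
    rfl
  rw [e1, Measure.volume_eq_prod, lintegral_prod _ (by
      refine (hH.comp (measurable_pi_lambda _ fun i => measurable_lift.comp ?_)).aemeasurable
      fun_prop)]
  have e2 : ∀ c : UnitAddTorus (Fin d),
      ∫⁻ u : Fin k → UnitAddTorus (Fin d), H (fun i => lift (u i - c)) = ∫⁻ z, H z := by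
    intro c
    have h2 := lintegral_sub_right_eq_self (μ := (volume : Measure (Fin k → UnitAddTorus (Fin d))))
      (fun u => H fun i => lift (u i)) (fun _ => c)
    simp only [Pi.sub_apply] at h2
    rw [h2]
    have h3 : MeasurePreserving
        (fun (z : Fin k → EuclideanSpace ℝ (Fin d)) i => proj (z i))
        (Measure.pi fun _ => volume.restrict (unitCube d)) (Measure.pi fun _ => volume) :=
      measurePreserving_pi _ _ fun i => measurePreserving_proj
    rw [← Measure.restrict_pi_pi] at h3
    rw [volume_pi, ← h3.lintegral_comp (f := fun u => H fun i => lift (u i)) (hH.comp hml), volume_pi]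
    have hC : MeasurableSet (Set.univ.pi fun _ : Fin k => unitCube d) :=
      MeasurableSet.univ_pi fun _ => measurableSet_unitCube
    -- The support of `H` lies in the product of cubes, where `lift` inverts `proj`.
    rw [← setLIntegral_eq_of_support_subset (s := Set.univ.pi fun _ : Fin k => unitCube d) (f := H)]
    · refine setLIntegral_congr_fun hC fun z hz => ?_
      congr 1
      funext i
      exact lift_proj_of_mem (hz i trivial)
    · intro z hz i _
      exact mem_unitCube_of_norm_lt (hsupp z hz i)
  simp only [e2, lintegral_const, measure_univ, mul_one]

end Lift

/-! ### The distribution of the circumradius under Lebesgue measure -/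

section Continuity

variable {k : ℕ} {V : Type*} [NormedAddCommGroup V] [InnerProductSpace ℝ V]

theorem continuous_gram : Continuous fun z : Fin k → V => Matrix.gram ℝ z := by
  refine continuous_matrix fun i j => ?_
  simp only [Matrix.gram_apply]
  fun_prop

/-- Cramer's rule isolates the only discontinuity in the factor `det⁻¹`. Continuity on independent
tuples and measurability everywhere follow from it. -/
theorem circumWeights_eq (z : Fin k → V) :
    circumWeights z = (Matrix.gram ℝ z).det⁻¹ •
      (Matrix.gram ℝ z).adjugate.mulVec fun i => ‖z i‖ ^ 2 / 2 := by
  rw [circumWeights, Matrix.inv_def, Ring.inverse_eq_inv, Matrix.smul_mulVec]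

theorem continuous_adjugate_gram_mulVec : Continuous fun z : Fin k → V =>
    (Matrix.gram ℝ z).adjugate.mulVec fun i => ‖z i‖ ^ 2 / 2 :=
  continuous_gram.matrix_adjugate.matrix_mulVec (by fun_prop)

theorem setOf_linearIndependent_eq :
    {z : Fin k → V | LinearIndependent ℝ z} = {z | (Matrix.gram ℝ z).det ≠ 0} := by
  ext z
  exact Matrix.det_gram_ne_zero_iff_linearIndependent.symm

theorem isOpen_setOf_linearIndependent_tuple : IsOpen {z : Fin k → V | LinearIndependent ℝ z} := by
  rw [setOf_linearIndependent_eq]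
  exact isOpen_ne_fun continuous_gram.matrix_det continuous_const

theorem continuousOn_circumWeights :
    ContinuousOn (circumWeights : (Fin k → V) → _) {z | LinearIndependent ℝ z} := by
  rw [setOf_linearIndependent_eq, funext circumWeights_eq]
  exact (continuous_gram.matrix_det.continuousOn.inv₀ fun _ hz => hz).smul
    continuous_adjugate_gram_mulVec.continuousOn

theorem continuousOn_centre :
    ContinuousOn (centre : (Fin k → V) → _) {z | LinearIndependent ℝ z} := by
  unfold centre
  refine continuousOn_finsetSum _ fun i _ => ContinuousOn.smul ?_ (by fun_prop)
  exact (continuous_apply i).comp_continuousOn continuousOn_circumWeights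

theorem isOpen_setOf_isCentred_lt (c : ℝ) :
    IsOpen {z : Fin k → V | IsCentred z ∧ ‖centre z‖ < c} := by
  have h : IsOpen {p : (Fin k → ℝ) × V | (∀ i, 0 < p.1 i) ∧ ∑ i, p.1 i < 1 ∧ ‖p.2‖ < c} := by
    simp only [Set.ofPred_and, Set.ofPred_forall]
    refine (isOpen_iInter_of_finite fun i => ?_).inter (IsOpen.inter ?_ ?_)
    · exact isOpen_lt (by fun_prop) (by fun_prop)
    · exact isOpen_lt (by fun_prop) (by fun_prop)
    · exact isOpen_lt (by fun_prop) (by fun_prop)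
  have h2 := (continuousOn_circumWeights (k := k) (V := V)).prodMk
    continuousOn_centre |>.isOpen_inter_preimage isOpen_setOf_linearIndependent_tuple h
  convert h2 using 1
  ext z
  simp [IsCentred, and_assoc]

variable [MeasurableSpace V] [BorelSpace V] [SecondCountableTopology V]

theorem measurable_circumWeights : Measurable (circumWeights : (Fin k → V) → _) := by
  rw [funext circumWeights_eq]
  exact (continuous_gram.matrix_det.measurable.inv).smul continuous_adjugate_gram_mulVec.measurable

theorem measurable_centre : Measurable (centre : (Fin k → V) → _) := by
  unfold centre
  refine Finset.measurable_sum _ fun i _ => Measurable.smul ?_ (measurable_pi_apply i)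
  exact (measurable_pi_apply i).comp measurable_circumWeights

theorem measurableSet_isCentred : MeasurableSet {z : Fin k → V | IsCentred z} := by
  simp only [IsCentred, Set.ofPred_and, Set.ofPred_forall]
  refine isOpen_setOf_linearIndependent_tuple.measurableSet.inter
    ((MeasurableSet.iInter fun i => ?_).inter ?_)
  · exact measurableSet_lt measurable_const ((measurable_pi_apply i).comp measurable_circumWeights)
  · exact measurableSet_lt (Finset.measurable_sum _ fun i _ =>
      (measurable_pi_apply i).comp measurable_circumWeights) measurable_const

end Continuity

/-- Take orthonormal vectors `e_i` and the unit vector `s` along their sum. The points `-s, e_1, …,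
e_k` lie on the unit sphere with `0` inside their simplex; translating by `s` moves the first point
to `0` and the circumcentre to `s`. As `∑ (e_j + s) = (√k + k) s`, all weights equal `1 / (√k + k)`.
-/
theorem exists_isCentred {d k : ℕ} (hkd : k ≤ d) :
    ∃ z : Fin k → EuclideanSpace ℝ (Fin d), IsCentred z := by
  rcases Nat.eq_zero_or_pos k with rfl | hk
  · exact ⟨fun i => i.elim0, linearIndependent_empty_type, fun i => i.elim0, by simp⟩
  let e : Fin k → EuclideanSpace ℝ (Fin d) := fun i => EuclideanSpace.single (Fin.castLE hkd i) 1
  have he : Orthonormal ℝ e :=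
    (EuclideanSpace.orthonormal_single (𝕜 := ℝ) (ι := Fin d)).comp _ (Fin.castLE_injective hkd)
  have hk0 : (0 : ℝ) < Real.sqrt k := Real.sqrt_pos.2 (by exact_mod_cast hk)
  have hks : Real.sqrt k * Real.sqrt k = k := Real.mul_self_sqrt (Nat.cast_nonneg _)
  set q := Real.sqrt k
  let s : EuclideanSpace ℝ (Fin d) := (1 / q) • ∑ j, e j
  have hse : ∀ i, inner ℝ s (e i) = 1 / q := by
    intro i
    simp only [s, inner_smul_left, sum_inner]
    rw [Finset.sum_eq_single i]
    · simp [he.1 i]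
    · exact fun j _ hj => he.2 hj
    · simp
  have hss : ‖s‖ ^ 2 = 1 := by
    rw [← real_inner_self_eq_norm_sq]
    nth_rw 2 [show s = (1 / q) • ∑ j, e j from rfl]
    rw [inner_smul_right, inner_sum]
    simp only [hse, Finset.sum_const, Finset.card_univ, Fintype.card_fin, nsmul_eq_mul, ← hks]
    field_simp
  have hee : ∀ i, ‖e i‖ ^ 2 = 1 := fun i => by rw [he.1 i, one_pow]
  refine ⟨fun i => e i + s, ((isCentred_and_eq_centre_iff _ s).2
    ⟨?_, fun _ => 1 / (q + k), fun _ => by positivity, ?_, ?_, ?_⟩).1⟩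
  · rw [Fintype.linearIndependent_iff]
    intro g hg
    have h1 : ∀ i, g i + (∑ j, g j) * (1 / q) = 0 := by
      intro i
      have h2 : inner ℝ (∑ j, g j • (e j + s)) (e i) = 0 := by rw [hg, inner_zero_left]
      simp only [smul_add, Finset.sum_add_distrib, inner_add_left, ← Finset.sum_smul] at h2
      rw [inner_smul_left, hse, sum_inner, Finset.sum_eq_single i] at h2
      · simpa [inner_smul_left, hee] using h2
      · exact fun j _ hj => by rw [inner_smul_left, he.2 hj, mul_zero]
      · simp
    have h3 : ∑ j, g j + k * ((∑ j, g j) * (1 / q)) = 0 := by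
      have := Finset.sum_eq_zero fun i (_ : i ∈ Finset.univ) => h1 i
      simpa [Finset.sum_add_distrib] using this
    have h4 : ∑ j, g j = 0 := by
      have : (∑ j, g j) * (1 + q) = 0 := by
        rw [← h3, ← hks]
        field_simp
      rcases mul_eq_zero.1 this with h | h
      · exact h
      · linarith
    intro i
    simpa [h4] using h1 i
  · simp only [Finset.sum_const, Finset.card_univ, Fintype.card_fin, nsmul_eq_mul]
    rw [mul_one_div, div_lt_one (by positivity)]
    linarith
  · rw [← Finset.smul_sum, Finset.sum_add_distrib]
    have : ∑ j, e j = q • s := by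
      simp only [s, smul_smul]
      rw [mul_one_div_cancel hk0.ne', one_smul]
    rw [this]
    simp only [Finset.sum_const, Finset.card_univ, Fintype.card_fin]
    rw [← Nat.cast_smul_eq_nsmul ℝ, ← add_smul, smul_smul, one_div_mul_cancel (by positivity),
      one_smul]
  · intro i
    rw [norm_add_sq_real, inner_add_right, hse, real_inner_self_eq_norm_sq, hss, real_inner_comm,
      hse, hee]
    ring

/-! ### Scaling, and the law of the volume of the circumball. -/

section Volume

open scoped Pointwise

variable {d k : ℕ}

theorem isCentred_and_norm_centre_le_eq_smul {τ : ℝ} (hτ : 0 < τ) :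
    {z : Fin k → EuclideanSpace ℝ (Fin d) | IsCentred z ∧ ‖centre z‖ ≤ τ} =
      τ • {z | IsCentred z ∧ ‖centre z‖ ≤ 1} := by
  ext z
  rw [Set.mem_smul_set_iff_inv_smul_mem₀ hτ.ne']
  have hτ' := inv_pos.2 hτ
  constructor
  · rintro ⟨h, hc⟩
    have h2 := isCentred_smul_and h hτ'
    refine ⟨h2.1, ?_⟩
    rw [← h2.2, norm_smul, Real.norm_of_nonneg hτ'.le, inv_mul_le_iff₀ hτ, mul_one]
    exact hc
  · rintro ⟨h, hc⟩
    have h2 := isCentred_smul_and h hτ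
    rw [smul_inv_smul₀ hτ.ne'] at h2
    refine ⟨h2.1, ?_⟩
    rw [← h2.2, norm_smul, Real.norm_of_nonneg hτ.le]
    exact mul_le_of_le_one_right hτ.le hc

theorem IsCentred.norm_centre_pos (hk : 1 ≤ k) {z : Fin k → EuclideanSpace ℝ (Fin d)}
    (hz : IsCentred z) : 0 < ‖centre z‖ := by
  have h1 := hz.norm_le ⟨0, hk⟩
  have h2 := norm_pos_iff.2 (hz.1.ne_zero ⟨0, hk⟩)
  linarith

theorem volume_centredTuples_ne_top (hk : 1 ≤ k) : volume (centredTuples d k) ≠ ⊤ := by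
  refine ((measure_mono ?_).trans_lt (measure_closedBall_lt_top (x := 0) (r := 2))).ne
  rw [centredTuples_eq hk]
  rintro z ⟨hz, hc⟩
  rw [mem_closedBall_zero_iff, pi_norm_le_iff_of_nonneg (by norm_num)]
  intro i
  linarith [hz.norm_le i]

theorem volume_centredTuples_pos (hk : 1 ≤ k) (hkd : k ≤ d) :
    0 < volume.real (centredTuples d k) := by
  refine ENNReal.toReal_pos ?_ (volume_centredTuples_ne_top hk)
  rw [centredTuples_eq hk]
  have hsub : {z : Fin k → EuclideanSpace ℝ (Fin d) | IsCentred z ∧ ‖centre z‖ < 1} ⊆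
      {z | IsCentred z ∧ ‖centre z‖ ≤ 1} := fun z hz => ⟨hz.1, hz.2.le⟩
  refine (((isOpen_setOf_isCentred_lt 1).measure_pos volume ?_).trans_le (measure_mono hsub)).ne'
  obtain ⟨z, hz⟩ := exists_isCentred hkd
  have h0 := hz.norm_centre_pos hk
  have h := isCentred_smul_and hz (a := (2 * ‖centre z‖)⁻¹) (by positivity)
  refine ⟨_, h.1, ?_⟩
  rw [← h.2, norm_smul, Real.norm_of_nonneg (by positivity)]
  field_simp
  norm_num

/-- For `τ > 0` this set is `τ` times `centredTuples d k` in dimension `d k`. For `τ = 0` it is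
empty, because a centred tuple has positive circumradius. -/
theorem volume_isCentred_le (hk : 1 ≤ k) (hd : 0 < d) {τ : ℝ} (hτ : 0 ≤ τ) :
    volume {z : Fin k → EuclideanSpace ℝ (Fin d) | IsCentred z ∧ ‖centre z‖ ≤ τ} =
      ENNReal.ofReal (volume.real (centredTuples d k) * τ ^ (d * k)) := by
  rcases hτ.eq_or_lt with rfl | hτ
  · have : {z : Fin k → EuclideanSpace ℝ (Fin d) | IsCentred z ∧ ‖centre z‖ ≤ 0} = ∅ := by
      ext z
      simp only [Set.mem_ofPred_eq, Set.mem_empty_iff_false, iff_false, not_and, not_le]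
      exact fun h => h.norm_centre_pos hk
    rw [this, measure_empty, zero_pow (by positivity), mul_zero, ENNReal.ofReal_zero]
  · rw [isCentred_and_norm_centre_le_eq_smul hτ, ← centredTuples_eq hk, Measure.addHaar_smul,
      Module.finrank_pi_fintype, mul_comm, ENNReal.ofReal_mul measureReal_nonneg,
      ofReal_measureReal (volume_centredTuples_ne_top hk)]
    simp only [finrank_euclideanSpace, Fintype.card_fin, Finset.sum_const, Finset.card_univ,
      smul_eq_mul]
    rw [abs_of_nonneg (by positivity), mul_comm k d]

/-- The volume of the ball that has the origin and the points `z_i` on its boundary. -/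
def circumVolume (z : Fin k → EuclideanSpace ℝ (Fin d)) : ℝ := ballVolume d * ‖centre z‖ ^ d

theorem measurable_circumVolume :
    Measurable (circumVolume : (Fin k → EuclideanSpace ℝ (Fin d)) → ℝ) := by
  unfold circumVolume
  exact (measurable_centre.norm.pow_const d).const_mul _

theorem circumVolume_le_iff (hd : 0 < d) (z : Fin k → EuclideanSpace ℝ (Fin d)) {τ : ℝ}
    (hτ : 0 ≤ τ) : circumVolume z ≤ ballVolume d * τ ^ d ↔ ‖centre z‖ ≤ τ := by
  rw [circumVolume, mul_le_mul_iff_right₀ (ballVolume_pos d),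
    pow_le_pow_iff_left₀ (norm_nonneg _) hτ hd.ne']

theorem volume_circumVolume_le (hk : 1 ≤ k) (hd : 0 < d) {s : ℝ} (hs : 0 ≤ s) :
    volume {z : Fin k → EuclideanSpace ℝ (Fin d) | IsCentred z ∧ circumVolume z ≤ s} =
      ENNReal.ofReal (volume.real (centredTuples d k) / ballVolume d ^ k * s ^ k) := by
  have hω := ballVolume_pos d
  set τ : ℝ := (s / ballVolume d) ^ ((d : ℝ)⁻¹) with hτ
  have hτ0 : 0 ≤ τ := by positivity
  have hτd : τ ^ d = s / ballVolume d :=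
    Real.rpow_inv_natCast_pow (by positivity) hd.ne'
  have hs' : s = ballVolume d * τ ^ d := by rw [hτd]; field_simp
  have : {z : Fin k → EuclideanSpace ℝ (Fin d) | IsCentred z ∧ circumVolume z ≤ s} =
      {z | IsCentred z ∧ ‖centre z‖ ≤ τ} := by
    ext z
    simp only [Set.mem_ofPred_eq]
    rw [hs', circumVolume_le_iff hd z hτ0]
  rw [this, volume_isCentred_le hk hd hτ0, pow_mul, hτd, div_pow]
  congr 1
  ring

theorem map_circumVolume (hk : 1 ≤ k) (hd : 0 < d) :
    (volume.restrict {z : Fin k → EuclideanSpace ℝ (Fin d) | IsCentred z}).map circumVolume =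
      (volume.restrict (Set.Ioi 0)).withDensity fun s => ENNReal.ofReal
        (volume.real (centredTuples d k) / ballVolume d ^ k * (k * s ^ (k - 1))) := by
  have hω := ballVolume_pos d
  set A : ℝ := volume.real (centredTuples d k) / ballVolume d ^ k with hA
  have hA0 : 0 ≤ A := by positivity
  have hpos : ∀ z : Fin k → EuclideanSpace ℝ (Fin d), IsCentred z → 0 < circumVolume z :=
    fun z hz => mul_pos hω (pow_pos (hz.norm_centre_pos hk) d)
  -- Differences of the distribution function `A s ^ k`. The truncation at `0` covers intervals
  -- reaching below `0`, where the law has no mass.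
  have left : ∀ a b : ℝ, a ≤ b →
      (volume.restrict {z : Fin k → EuclideanSpace ℝ (Fin d) | IsCentred z}).map circumVolume
        (Set.Ioc a b) = ENNReal.ofReal (A * (max b 0 ^ k - max a 0 ^ k)) := by
    intro a b hab
    rw [Measure.map_apply measurable_circumVolume measurableSet_Ioc,
      Measure.restrict_apply (measurable_circumVolume measurableSet_Ioc)]
    have e : circumVolume ⁻¹' Set.Ioc a b ∩
        {z : Fin k → EuclideanSpace ℝ (Fin d) | IsCentred z} =
        {z | IsCentred z ∧ circumVolume z ≤ max b 0} \
          {z | IsCentred z ∧ circumVolume z ≤ max a 0} := by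
      ext z
      simp only [Set.mem_inter_iff, Set.mem_preimage, Set.mem_Ioc, Set.mem_ofPred_eq,
        Set.mem_sdiff, not_and, not_le]
      constructor
      · rintro ⟨⟨h1, h2⟩, h3⟩
        exact ⟨⟨h3, h2.trans (le_max_left _ _)⟩, fun _ => max_lt h1 (hpos z h3)⟩
      · rintro ⟨⟨h3, h2⟩, h1⟩
        refine ⟨⟨(le_max_left _ _).trans_lt (h1 h3), ?_⟩, h3⟩
        rcases le_max_iff.1 h2 with h | h
        · exact h
        · exact absurd h (hpos z h3).not_ge
    rw [e, measure_sdiff, volume_circumVolume_le hk hd (le_max_right _ _),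
      volume_circumVolume_le hk hd (le_max_right _ _), ← ENNReal.ofReal_sub _ (by positivity),
      mul_sub]
    · exact fun z hz => ⟨hz.1, hz.2.trans (max_le_max_right 0 hab)⟩
    · exact (measurableSet_isCentred.inter
        (measurableSet_le measurable_circumVolume measurable_const)).nullMeasurableSet
    · rw [volume_circumVolume_le hk hd (le_max_right _ _)]
      exact ENNReal.ofReal_ne_top
  refine Measure.ext_of_Ioc' _ _ (fun a b hab => ?_) fun a b hab => ?_
  · rw [left a b hab.le]
    exact ENNReal.ofReal_ne_top
  · rw [left a b hab.le, withDensity_apply _ measurableSet_Ioc,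
      Measure.restrict_restrict measurableSet_Ioc]
    have e : Set.Ioc a b ∩ Set.Ioi 0 = Set.Ioc (max a 0) (max b 0) := by
      ext s
      simp only [Set.mem_inter_iff, Set.mem_Ioc, Set.mem_Ioi, max_lt_iff, le_max_iff]
      constructor
      · rintro ⟨⟨h1, h2⟩, h3⟩
        exact ⟨⟨h1, h3⟩, .inl h2⟩
      · rintro ⟨⟨h1, h3⟩, h2⟩
        exact ⟨⟨h1, h2.resolve_right h3.not_ge⟩, h3⟩
    have hmax : max a 0 ≤ max b 0 := max_le_max_right 0 hab.le
    rw [e, ← ofReal_integral_eq_lintegral_ofReal, ← intervalIntegral.integral_of_le hmax,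
      intervalIntegral.integral_const_mul, intervalIntegral.integral_const_mul, integral_pow]
    · congr 2
      have : ((k - 1 : ℕ) : ℝ) + 1 = k := by
        rw [Nat.cast_sub hk]; simp
      rw [this, Nat.sub_add_cancel hk]
      have : (k : ℝ) ≠ 0 := by positivity
      field_simp
    · exact (Continuous.integrableOn_Ioc (by fun_prop))
    · refine (ae_restrict_iff' measurableSet_Ioc).2 (Eventually.of_forall fun s hs => ?_)
      have : 0 ≤ s := (le_max_right a 0).trans hs.1.le
      simp only [Pi.zero_apply]
      positivity

theorem lintegral_comp_circumVolume (hk : 1 ≤ k) (hd : 0 < d) {g : ℝ → ENNReal}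
    (hg : Measurable g) :
    ∫⁻ z in {z : Fin k → EuclideanSpace ℝ (Fin d) | IsCentred z}, g (circumVolume z) =
      ∫⁻ s in Set.Ioi 0, ENNReal.ofReal
        (volume.real (centredTuples d k) / ballVolume d ^ k * (k * s ^ (k - 1))) * g s := by
  rw [← lintegral_map hg measurable_circumVolume, map_circumVolume hk hd,
    lintegral_withDensity_eq_lintegral_mul _ (by fun_prop) hg]
  rfl

end Volume

/-! ### Critical points and tuples of points -/

section Tuples

variable {d k : ℕ}

/-- The points `x_1, …, x_k` of the torus relative to `x_0`. -/
def edgeVectors (x : Fin (k + 1) → UnitAddTorus (Fin d)) : Fin k → EuclideanSpace ℝ (Fin d) :=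
  fun i => lift (x i.succ - x 0)

/-- The circumcentre of a tuple of nearby points of the torus. -/
def tupleCentre (x : Fin (k + 1) → UnitAddTorus (Fin d)) : UnitAddTorus (Fin d) :=
  x 0 + proj (centre (edgeVectors x))

/-- The circumradius of a tuple of nearby points of the torus. -/
def tupleRadius (x : Fin (k + 1) → UnitAddTorus (Fin d)) : ℝ := ‖centre (edgeVectors x)‖

/-- The circumcentre of the tuple lies in the open simplex that it spans, and the circumradius lies
in `(r, r_max]`. -/
def IsAdmissible (r : ℝ) (x : Fin (k + 1) → UnitAddTorus (Fin d)) : Prop :=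
  IsCentred (edgeVectors x) ∧ r < tupleRadius x ∧ tupleRadius x ≤ rMax

/-- The tuples of points of `P` that give rise to a critical point of index `k`. -/
def criticalTuples (P : Set (UnitAddTorus (Fin d))) (k : ℕ) (r : ℝ) :
    Set (Fin (k + 1) → UnitAddTorus (Fin d)) :=
  {x | (∀ i, x i ∈ P) ∧ IsAdmissible r x ∧
    ∀ p ∈ P, p ∉ Set.range x → tupleRadius x < torusDist (tupleCentre x) p}

theorem proj_injective_of_norm_lt {v w : EuclideanSpace ℝ (Fin d)} (hv : ‖v‖ < 1 / 2)
    (hw : ‖w‖ < 1 / 2) (h : proj v = proj w) : v = w := by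
  rw [← lift_proj hv, h, lift_proj hw]

/-- Two vertices differ by at most `2 r_max = 1/3 < 1/2`, so `lift` recovers the true Euclidean edge
vectors from the torus points. -/
theorem isCentred_edgeVectors_of_simplex (hk : 1 ≤ k)
    {s : Affine.Simplex ℝ (EuclideanSpace ℝ (Fin d)) k} {R : ℝ} (hs : ∀ i, ‖s.points i‖ = R)
    (hR : R ≤ rMax) (h0 : 0 ∈ s.interior) (c : UnitAddTorus (Fin d)) :
    IsCentred (edgeVectors fun i => c + proj (s.points i)) ∧
      tupleCentre (fun i => c + proj (s.points i)) = c ∧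
      tupleRadius (fun i => c + proj (s.points i)) = R := by
  have he : edgeVectors (fun i => c + proj (s.points i)) =
      fun i : Fin k => s.points i.succ - s.points 0 := by
    funext i
    rw [edgeVectors, add_sub_add_left_eq_sub, ← proj_sub, lift_proj]
    refine (norm_sub_le _ _).trans_lt ?_
    rw [hs, hs]
    unfold rMax rConv at hR
    linarith
  obtain ⟨h1, h2⟩ := (exists_simplex_iff hk s.points 0).1 ⟨s, rfl, h0, fun i => by
    rw [dist_zero_left, dist_zero_left, hs, hs]⟩
  rw [← he, zero_sub] at h2
  refine ⟨by rwa [he], ?_, ?_⟩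
  · rw [tupleCentre, ← h2, proj_neg, add_neg_cancel_right]
  · rw [tupleRadius, ← h2, norm_neg, hs]

/-- The simplex is the tuple as seen from its circumcentre: `0` and the edge vectors, translated by
`-centre z`. -/
theorem IsAdmissible.exists_simplex (hk : 1 ≤ k) {r : ℝ}
    {x : Fin (k + 1) → UnitAddTorus (Fin d)} (hx : IsAdmissible r x) :
    ∃ s : Affine.Simplex ℝ (EuclideanSpace ℝ (Fin d)) k, 0 ∈ s.interior ∧
      (∀ i, ‖s.points i‖ = tupleRadius x) ∧
      ∀ i, x i = tupleCentre x + proj (s.points i) := by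
  set z := edgeVectors x with hz
  let q : Fin (k + 1) → EuclideanSpace ℝ (Fin d) := Fin.cons (-centre z) fun i => z i - centre z
  have hq : ∀ i, ‖q i‖ = tupleRadius x := by
    rw [Fin.forall_fin_succ]
    refine ⟨by simp [q, tupleRadius, hz], fun i => ?_⟩
    simp only [q, Fin.cons_succ]
    rw [norm_sub_rev, hx.1.norm_centre_sub]
    rfl
  have he : (fun i : Fin k => q i.succ - q 0) = z := by
    funext i
    simp [q]
  obtain ⟨s, hs, h0, -⟩ := (exists_simplex_iff hk q 0).2 ⟨by rw [he]; exact hx.1, by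
    rw [he]
    simp [q]⟩
  refine ⟨s, h0, by rwa [hs], ?_⟩
  rw [hs, Fin.forall_fin_succ]
  refine ⟨by simp [q, tupleCentre, proj_neg, hz], fun i => ?_⟩
  simp only [q, Fin.cons_succ, tupleCentre]
  rw [proj_sub, ← hz, add_add_sub_cancel, hz, edgeVectors, proj_lift]
  abel

theorem IsAdmissible.tupleRadius_lt {r : ℝ} {x : Fin (k + 1) → UnitAddTorus (Fin d)}
    (hx : IsAdmissible r x) : tupleRadius x < 1 / 2 := by
  have := hx.2.2
  unfold rMax rConv at this
  linarith

theorem IsAdmissible.torusDist_tupleCentre (hk : 1 ≤ k) {r : ℝ}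
    {x : Fin (k + 1) → UnitAddTorus (Fin d)} (hx : IsAdmissible r x) (i : Fin (k + 1)) :
    torusDist (tupleCentre x) (x i) = tupleRadius x := by
  obtain ⟨s, -, hs, h⟩ := hx.exists_simplex hk
  rw [h i, torusDist_add_proj _ (by rw [hs]; exact hx.tupleRadius_lt), hs]

theorem IsAdmissible.injective (hk : 1 ≤ k) {r : ℝ}
    {x : Fin (k + 1) → UnitAddTorus (Fin d)} (hx : IsAdmissible r x) : Function.Injective x := by
  obtain ⟨s, -, hs, h⟩ := hx.exists_simplex hk
  intro i j hij
  rw [h i, h j, add_right_inj] at hij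
  exact s.independent.injective (proj_injective_of_norm_lt (by rw [hs]; exact hx.tupleRadius_lt)
    (by rw [hs]; exact hx.tupleRadius_lt) hij)

variable {P : Set (UnitAddTorus (Fin d))} {r : ℝ}

theorem torusDistFn_eq_of_isLeast {c : UnitAddTorus (Fin d)} {R : ℝ}
    (h : ∀ p ∈ P, R ≤ torusDist c p) {p : UnitAddTorus (Fin d)} (hp : p ∈ P)
    (hpR : torusDist c p = R) : torusDistFn P c = R := by
  refine IsLeast.csInf_eq ⟨⟨p, hp, hpR⟩, ?_⟩
  rintro _ ⟨p, hp, rfl⟩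
  exact h p hp

theorem le_torusDist_of_mem_criticalTuples (hk : 1 ≤ k)
    {x : Fin (k + 1) → UnitAddTorus (Fin d)} (hx : x ∈ criticalTuples P k r)
    {p : UnitAddTorus (Fin d)} (hp : p ∈ P) : tupleRadius x ≤ torusDist (tupleCentre x) p := by
  by_cases h : p ∈ Set.range x
  · obtain ⟨i, rfl⟩ := h
    exact (hx.2.1.torusDist_tupleCentre hk i).ge
  · exact (hx.2.2 p hp h).le

theorem torusDistFn_tupleCentre (hk : 1 ≤ k)
    {x : Fin (k + 1) → UnitAddTorus (Fin d)} (hx : x ∈ criticalTuples P k r) :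
    torusDistFn P (tupleCentre x) = tupleRadius x :=
  torusDistFn_eq_of_isLeast (fun _ => le_torusDist_of_mem_criticalTuples hk hx) (hx.1 0)
    (hx.2.1.torusDist_tupleCentre hk 0)

/-- The right-hand side depends on `x` only through its circumcentre, so critical tuples with the
same centre have the same points. -/
theorem range_eq_of_mem_criticalTuples (hk : 1 ≤ k)
    {x : Fin (k + 1) → UnitAddTorus (Fin d)} (hx : x ∈ criticalTuples P k r) :
    Set.range x = {p ∈ P | torusDist (tupleCentre x) p = torusDistFn P (tupleCentre x)} := by
  rw [torusDistFn_tupleCentre hk hx]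
  ext p
  constructor
  · rintro ⟨i, rfl⟩
    exact ⟨hx.1 i, hx.2.1.torusDist_tupleCentre hk i⟩
  · rintro ⟨hp, h⟩
    by_contra hn
    exact (hx.2.2 p hp hn).ne' h

theorem tupleCentre_mem_remainingCriticalPoints (hk : 1 ≤ k)
    {x : Fin (k + 1) → UnitAddTorus (Fin d)} (hx : x ∈ criticalTuples P k r) :
    tupleCentre x ∈ remainingCriticalPoints P k r := by
  have hlt := hx.2.1.tupleRadius_lt
  obtain ⟨s, h0, hs, h⟩ := hx.2.1.exists_simplex hk
  have hmem : ∀ i, s.points i ∈ localLift P (tupleCentre x) := fun i =>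
    ⟨by rw [hs, rConv]; exact hlt, by rw [← h]; exact hx.1 i⟩
  have hinf : Metric.infDist 0 (localLift P (tupleCentre x)) = tupleRadius x := by
    refine le_antisymm ?_ ((Metric.le_infDist ⟨_, hmem 0⟩).2 fun {v} hv => ?_)
    · rw [← hs 0, ← dist_zero_left]
      exact Metric.infDist_le_dist_of_mem (hmem 0)
    · rw [dist_zero_left, ← torusDist_add_proj (tupleCentre x) hv.1]
      exact le_torusDist_of_mem_criticalTuples hk hx hv.2
  refine ⟨⟨s, ?_, ?_, ?_, h0⟩, ?_⟩
  · rintro _ ⟨i, rfl⟩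
    exact hmem i
  · intro i
    rw [hinf, dist_zero_left, hs]
  · intro v hv hvs
    rw [hinf, dist_zero_left, ← torusDist_add_proj (tupleCentre x) hv.1]
    refine hx.2.2 _ hv.2 ?_
    rintro ⟨i, hi⟩
    rw [h i, add_right_inj] at hi
    exact hvs ⟨i, proj_injective_of_norm_lt (by rw [hs]; exact hlt) hv.1 hi⟩
  · rw [torusDistFn_tupleCentre hk hx]
    exact hx.2.1.2

/-- All reorderings are treated at once because the count below needs the whole fibre of
`tupleCentre` over `c`. -/
theorem exists_criticalTuples_of_mem (hk : 1 ≤ k) {c : UnitAddTorus (Fin d)}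
    (hc : c ∈ remainingCriticalPoints P k r) :
    ∃ x : Fin (k + 1) → UnitAddTorus (Fin d), ∀ σ : Equiv.Perm (Fin (k + 1)),
      x ∘ σ ∈ criticalTuples P k r ∧ tupleCentre (x ∘ σ) = c := by
  obtain ⟨⟨s, hsub, hd, hfar, h0⟩, hr, hmax⟩ := hc
  set R := Metric.infDist 0 (localLift P c)
  simp only [dist_zero_left] at hd hfar
  have hmem : ∀ i, s.points i ∈ localLift P c := fun i => hsub ⟨i, rfl⟩
  have hR : R < 1 / 2 := (hd 0) ▸ (hmem 0).1
  -- The infimum `R` sees only the points of the chart; those outside it are at distance at least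
  -- `1/2 > R`.
  have hle : ∀ p ∈ P, R ≤ torusDist c p := by
    intro p hp
    rw [torusDist_eq]
    by_cases hlt : ‖lift (p - c)‖ < 1 / 2
    · rw [← dist_zero_left]
      refine Metric.infDist_le_dist_of_mem ⟨hlt, ?_⟩
      rwa [proj_lift, add_sub_cancel]
    · exact hR.le.trans (not_lt.1 hlt)
  have hfn : torusDistFn P c = R :=
    torusDistFn_eq_of_isLeast hle (hmem 0).2 (by rw [torusDist_add_proj _ (hmem 0).1, hd])
  rw [hfn] at hr hmax
  refine ⟨fun i => c + proj (s.points i), fun σ => ?_⟩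
  have hx : (fun i => c + proj (s.points i)) ∘ σ =
      fun i => c + proj ((s.reindex σ.symm).points i) := by
    funext i
    simp
  obtain ⟨h1, h2, h3⟩ := isCentred_edgeVectors_of_simplex hk (s := s.reindex σ.symm) (R := R)
    (fun i => by simp [hd]) hmax (by rwa [Affine.Simplex.interior_reindex]) c
  rw [hx]
  refine ⟨⟨fun i => by simpa using (hmem _).2, ⟨h1, by rwa [h3], by rwa [h3]⟩, ?_⟩, h2⟩
  intro p hp hpn
  rw [h2, h3]
  refine lt_of_le_of_ne (hle p hp) fun heq => ?_
  have hpl : ‖lift (p - c)‖ = R := by rw [← torusDist_eq, heq]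
  have hpc : c + proj (lift (p - c)) = p := by rw [proj_lift, add_sub_cancel]
  by_cases hv : lift (p - c) ∈ Set.range s.points
  · obtain ⟨i, hi⟩ := hv
    refine hpn ⟨σ.symm i, ?_⟩
    simp [hi, hpc]
  · refine (hfar _ ⟨by rw [hpl]; exact hR, by rwa [hpc]⟩ hv).ne' hpl

theorem exists_perm_of_range_eq {α β : Type*} {f g : α → β} (hf : Function.Injective f)
    (hg : Function.Injective g) (h : Set.range f = Set.range g) :
    ∃ σ : Equiv.Perm α, g = f ∘ σ := by
  refine ⟨((Equiv.ofInjective g hg).trans (Equiv.setCongr h.symm)).trans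
    (Equiv.ofInjective f hf).symm, ?_⟩
  funext i
  simp only [Function.comp_apply, Equiv.trans_apply]
  rw [Equiv.apply_ofInjective_symm hf]
  rfl

theorem remainingCriticalPoints_eq_image (hk : 1 ≤ k) :
    remainingCriticalPoints P k r = tupleCentre '' criticalTuples P k r := by
  ext c
  constructor
  · intro hc
    obtain ⟨x, hx⟩ := exists_criticalTuples_of_mem hk hc
    exact ⟨x, (hx 1)⟩
  · rintro ⟨x, hx, rfl⟩
    exact tupleCentre_mem_remainingCriticalPoints hk hx

theorem finite_criticalTuples (hP : P.Finite) : (criticalTuples P k r).Finite :=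
  (Set.Finite.pi fun _ : Fin (k + 1) => hP).subset fun _ hx i _ => hx.1 i

theorem finite_remainingCriticalPoints (hk : 1 ≤ k) (hP : P.Finite) :
    (remainingCriticalPoints P k r).Finite := by
  rw [remainingCriticalPoints_eq_image hk]
  exact (finite_criticalTuples hP).image _

/-- Each fibre of `tupleCentre` is one orbit of the permutations of the `k + 1` positions, and the
action is free because admissible tuples are injective. -/
theorem ncard_criticalTuples (hk : 1 ≤ k) (hP : P.Finite) :
    (criticalTuples P k r).ncard = (k + 1).factorial * remainingCount P k r := by
  classical
  rw [remainingCount, Set.ncard_eq_toFinset_card _ (finite_criticalTuples hP),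
    Set.ncard_eq_toFinset_card _ (finite_remainingCriticalPoints hk hP),
    Finset.card_eq_sum_card_fiberwise (f := tupleCentre)
      (t := (finite_remainingCriticalPoints (r := r) hk hP).toFinset)]
  · rw [Finset.sum_const_nat, mul_comm]
    intro c hc
    rw [Set.Finite.mem_toFinset] at hc
    obtain ⟨x, hx⟩ := exists_criticalTuples_of_mem hk hc
    have hinj : Function.Injective x := (hx 1).1.2.1.injective hk
    have : ({y ∈ (finite_criticalTuples (r := r) hP).toFinset | tupleCentre y = c} :
        Finset (Fin (k + 1) → UnitAddTorus (Fin d))) =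
        (Finset.univ : Finset (Equiv.Perm (Fin (k + 1)))).image (fun σ : Equiv.Perm (Fin (k + 1)) => x ∘ σ) := by
      ext y
      simp only [Finset.mem_filter, Set.Finite.mem_toFinset, Finset.mem_image, Finset.mem_univ,
        true_and]
      constructor
      · rintro ⟨hy, hyc⟩
        have h1 := range_eq_of_mem_criticalTuples hk hy
        have h2 := range_eq_of_mem_criticalTuples hk (hx 1).1
        rw [(hx 1).2] at h2
        rw [hyc, ← h2] at h1
        obtain ⟨σ, hσ⟩ := exists_perm_of_range_eq hinj (hy.2.1.injective hk) h1.symm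
        exact ⟨σ, hσ.symm⟩
      · rintro ⟨σ, rfl⟩
        exact hx σ
    rw [this, Finset.card_image_of_injective, Finset.card_univ, Fintype.card_perm,
      Fintype.card_fin]
    intro σ τ h
    ext i
    exact congrArg Fin.val (hinj (congrFun h i))
  · intro x hx
    simp only [Set.Finite.coe_toFinset] at hx ⊢
    exact tupleCentre_mem_remainingCriticalPoints hk hx

/-- The indicator that the tuple `x` is admissible and that the points `y_i` are all outside of the
closed ball that has the points of the tuple on its boundary. -/
def tupleTerm (r : ℝ) {ι : Type*} [Fintype ι] (x : Fin (k + 1) → UnitAddTorus (Fin d))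
    (y : ι → UnitAddTorus (Fin d)) : ENNReal :=
  {x | IsAdmissible r x}.indicator 1 x *
    ∏ i, {p | tupleRadius x < torusDist (tupleCentre x) p}.indicator 1 (y i)

theorem tupleTerm_eq_ite (r : ℝ) {ι : Type*} [Fintype ι]
    (x : Fin (k + 1) → UnitAddTorus (Fin d)) (y : ι → UnitAddTorus (Fin d))
    [Decidable (IsAdmissible r x ∧ ∀ i, tupleRadius x < torusDist (tupleCentre x) (y i))] :
    tupleTerm r x y = if IsAdmissible r x ∧
      ∀ i, tupleRadius x < torusDist (tupleCentre x) (y i) then 1 else 0 := by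
  classical
  simp only [tupleTerm, Set.indicator_apply, Set.mem_ofPred_eq, Pi.one_apply]
  by_cases h1 : IsAdmissible r x
  · by_cases h2 : ∀ i, tupleRadius x < torusDist (tupleCentre x) (y i)
    · simp [h1, h2]
    · have h3 := h2
      push Not at h2
      obtain ⟨i, hi⟩ := h2
      simp only [h1, h3, and_false, if_false, if_true, one_mul]
      exact Finset.prod_eq_zero (Finset.mem_univ i) (if_neg hi.not_gt)
  · simp [h1]

-- Distinct sample points turn critical tuples into injections of indices. The sum then ranges over
-- a deterministic set, so its expectation can be taken term by term.
open Classical in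
theorem ncard_criticalTuples_range (hk : 1 ≤ k) {m : ℕ} {y : Fin m → UnitAddTorus (Fin d)}
    (hy : Function.Injective y) :
    ((criticalTuples (Set.range y) k r).ncard : ENNReal) =
      ∑ j : Fin (k + 1) ↪ Fin m,
        tupleTerm r (y ∘ j) fun i : {i // i ∉ Set.range j} => y i := by
  have h : criticalTuples (Set.range y) k r = (fun j : Fin (k + 1) ↪ Fin m => y ∘ j) ''
      {j | IsAdmissible r (y ∘ j) ∧ ∀ i : {i // i ∉ Set.range j},
        tupleRadius (y ∘ j) < torusDist (tupleCentre (y ∘ j)) (y i)} := by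
    ext x
    constructor
    · rintro ⟨h1, h2, h3⟩
      choose j hj using h1
      have hx : y ∘ j = x := funext hj
      have hji : Function.Injective j := by
        have := h2.injective hk
        rw [← hx] at this
        exact this.of_comp
      refine ⟨⟨j, hji⟩, ⟨?_, ?_⟩, hx⟩
      · simpa [hx] using h2
      · rintro ⟨i, hi⟩
        simp only [Function.Embedding.coeFn_mk, hx]
        refine h3 _ ⟨i, rfl⟩ ?_
        rintro ⟨a, ha⟩
        rw [← hj] at ha
        exact hi ⟨a, hy ha⟩
    · rintro ⟨j, ⟨h2, h3⟩, rfl⟩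
      refine ⟨fun i => ⟨j i, rfl⟩, h2, ?_⟩
      rintro _ ⟨i, rfl⟩ hi
      refine h3 ⟨i, ?_⟩
      rintro ⟨a, rfl⟩
      exact hi ⟨a, rfl⟩
  rw [h, Set.ncard_image_of_injective, Set.ncard_eq_toFinset_card']
  · simp only [tupleTerm_eq_ite, Finset.sum_boole]
    congr 2
    ext j
    simp
  · intro j j' hjj
    ext i
    exact congrArg Fin.val (hy (congrFun hjj i))

end Tuples

/-! ### The expected number of critical points -/

section Measurability

variable {d k : ℕ}

theorem measurable_edgeVectors :
    Measurable (edgeVectors : (Fin (k + 1) → UnitAddTorus (Fin d)) → _) := by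
  unfold edgeVectors
  refine measurable_pi_lambda _ fun i => measurable_lift.comp ?_
  fun_prop

theorem measurable_tupleCentre :
    Measurable (tupleCentre : (Fin (k + 1) → UnitAddTorus (Fin d)) → _) := by
  unfold tupleCentre
  exact (measurable_pi_apply 0).add
    (continuous_proj.measurable.comp (measurable_centre.comp measurable_edgeVectors))

theorem measurable_tupleRadius :
    Measurable (tupleRadius : (Fin (k + 1) → UnitAddTorus (Fin d)) → _) :=
  (measurable_centre.comp measurable_edgeVectors).norm

theorem measurableSet_isAdmissible (r : ℝ) :
    MeasurableSet {x : Fin (k + 1) → UnitAddTorus (Fin d) | IsAdmissible r x} :=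
  (measurable_edgeVectors measurableSet_isCentred).inter
    ((measurableSet_lt measurable_const measurable_tupleRadius).inter
      (measurableSet_le measurable_tupleRadius measurable_const))

theorem measurable_tupleTerm (r : ℝ) {ι : Type*} [Fintype ι] {α : Type*} [MeasurableSpace α]
    {f : α → Fin (k + 1) → UnitAddTorus (Fin d)} {g : α → ι → UnitAddTorus (Fin d)}
    (hf : Measurable f) (hg : Measurable g) : Measurable fun a => tupleTerm r (f a) (g a) := by
  unfold tupleTerm
  refine Measurable.mul ?_ (Finset.measurable_prod _ fun i _ => ?_)
  · exact (measurable_one.indicator (measurableSet_isAdmissible r)).comp hf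
  · have hS : MeasurableSet {a | tupleRadius (f a) < torusDist (tupleCentre (f a)) (g a i)} :=
      measurableSet_lt (measurable_tupleRadius.comp hf)
        (measurable_torusDist (measurable_tupleCentre.comp hf) ((measurable_pi_apply i).comp hg))
    exact (measurable_const (a := (1 : ENNReal))).indicator hS

/-- For a fixed tuple the remaining points are independent, and each avoids the circumball with
probability `1 - V`. -/
theorem lintegral_tupleTerm_right (r : ℝ) {ι : Type*} [Fintype ι]
    (x : Fin (k + 1) → UnitAddTorus (Fin d)) :
    ∫⁻ y : ι → UnitAddTorus (Fin d), tupleTerm r x y =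
      {x | IsAdmissible r x}.indicator (fun x => ENNReal.ofReal
        (1 - circumVolume (edgeVectors x)) ^ Fintype.card ι) x := by
  by_cases hx : IsAdmissible r x
  · have hS : MeasurableSet {p | tupleRadius x < torusDist (tupleCentre x) p} :=
      measurableSet_lt measurable_const (continuous_torusDist_right _).measurable
    have : ∀ y : ι → UnitAddTorus (Fin d), tupleTerm r x y =
        (Set.univ.pi fun _ => {p | tupleRadius x < torusDist (tupleCentre x) p}).indicator 1 y := by
      classical
      intro y
      rw [tupleTerm_eq_ite, Set.indicator_apply]
      simp [hx]
    simp_rw [this]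
    rw [lintegral_indicator_one (MeasurableSet.univ_pi fun _ => hS), volume_pi, Measure.pi_pi,
      Set.indicator_of_mem (by exact hx), volume_lt_torusDist (R := tupleRadius x) _
        (norm_nonneg _) hx.tupleRadius_lt]
    simp [circumVolume, tupleRadius]
  · rw [Set.indicator_of_notMem (by exact hx)]
    have : ∀ y : ι → UnitAddTorus (Fin d), tupleTerm r x y = 0 := by
      intro y
      rw [tupleTerm, Set.indicator_of_notMem (by exact hx), zero_mul]
    simp [this]

/-- The probability that a given tuple of `m` uniform points gives rise to a critical point. -/
def tupleProb (d k : ℕ) (r : ℝ) (m : ℕ) : ENNReal :=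
  ∫⁻ x in {x : Fin (k + 1) → UnitAddTorus (Fin d) | IsAdmissible r x},
    ENNReal.ofReal (1 - circumVolume (edgeVectors x)) ^ (m - (k + 1))

theorem lintegral_tupleTerm (r : ℝ) {m : ℕ} (j : Fin (k + 1) ↪ Fin m)
    [Fintype {i // i ∉ Set.range j}] :
    ∫⁻ q : (Fin (k + 1) → UnitAddTorus (Fin d)) × ({i // i ∉ Set.range j} → UnitAddTorus (Fin d)),
      tupleTerm r q.1 q.2 = tupleProb d k r m := by
  rw [Measure.volume_eq_prod, lintegral_prod _ (measurable_tupleTerm r measurable_fst measurable_snd).aemeasurable]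
  simp_rw [lintegral_tupleTerm_right]
  rw [lintegral_indicator (measurableSet_isAdmissible r), tupleProb]
  have : Fintype.card {i // i ∉ Set.range j} = m - (k + 1) := by
    classical
    rw [Fintype.card_subtype_compl, Fintype.card_fin]
    congr 1
    exact (Fintype.card_congr (Equiv.ofInjective j j.injective)).symm.trans (Fintype.card_fin _)
  rw [this]

end Measurability

/-! ### Averaging over the Poisson sample. -/

section Sample

theorem pointSet_eq_range {d : ℕ} {Ω : Type*} (X : ℕ → Ω → UnitAddTorus (Fin d)) (N : Ω → ℕ)
    (ω : Ω) : pointSet X N ω = Set.range fun i : Fin (N ω) => X i ω := by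
  ext p
  constructor
  · rintro ⟨i, hi, rfl⟩
    exact ⟨⟨i, hi⟩, rfl⟩
  · rintro ⟨i, rfl⟩
    exact ⟨i, i.2, rfl⟩

theorem finite_pointSet {d : ℕ} {Ω : Type*} (X : ℕ → Ω → UnitAddTorus (Fin d)) (N : Ω → ℕ)
    (ω : Ω) : (pointSet X N ω).Finite :=
  (Set.finite_Iio _).image _

variable {d k : ℕ} {Ω : Type*} [MeasurableSpace Ω] {μ : Measure Ω}
  {n : ℝ≥0} {X : ℕ → Ω → UnitAddTorus (Fin d)} {N : Ω → ℕ}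

theorem IsPoissonSample.measurable_points' (hP : IsPoissonSample μ n X N) :
    Measurable fun ω i => X i ω :=
  measurable_pi_lambda _ hP.measurable_points

theorem IsPoissonSample.measurable_indicator_count (hP : IsPoissonSample μ n X N) (m : ℕ) :
    Measurable fun ω => (({m} : Set ℕ).indicator 1 (N ω) : ENNReal) :=
  (measurable_one.indicator (measurableSet_singleton m)).comp hP.measurable_count

open Classical in
/-- The number of tuples that give rise to a critical point of the first `m` points of `x`. -/
def tupleCount (k : ℕ) (r : ℝ) (m : ℕ) (x : ℕ → UnitAddTorus (Fin d)) : ENNReal :=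
  ∑ j : Fin (k + 1) ↪ Fin m,
    tupleTerm r (fun a => x (j a)) fun i : {i // i ∉ Set.range j} => x i

theorem measurable_tupleCount (r : ℝ) (m : ℕ) :
    Measurable (tupleCount k r m : (ℕ → UnitAddTorus (Fin d)) → ENNReal) := by
  classical
  unfold tupleCount
  refine Finset.measurable_sum _ fun j _ => ?_
  exact measurable_tupleTerm r (measurable_pi_lambda _ fun _ => measurable_pi_apply _)
    (measurable_pi_lambda _ fun _ => measurable_pi_apply _)

/-- The number of tuples that give rise to a critical point of the Poisson process. -/
def poissonTupleCount (k : ℕ) (r : ℝ) (X : ℕ → Ω → UnitAddTorus (Fin d)) (N : Ω → ℕ) (ω : Ω) :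
    ENNReal :=
  ∑' m, (({m} : Set ℕ).indicator 1 (N ω)) * tupleCount k r m fun i => X i ω

theorem IsPoissonSample.measurable_poissonTupleCount (hP : IsPoissonSample μ n X N) (r : ℝ) :
    Measurable (poissonTupleCount k r X N) := by
  refine Measurable.tsum fun m => (hP.measurable_indicator_count m).mul ?_
  exact (measurable_tupleCount r m).comp hP.measurable_points'

variable [IsProbabilityMeasure μ]

theorem IsPoissonSample.measurePreserving (hP : IsPoissonSample μ n X N) {κ : Type*} [Fintype κ]
    {e : κ → ℕ} (he : Function.Injective e) :
    MeasurePreserving (fun ω s => X (e s) ω) μ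
      (volume : Measure (κ → UnitAddTorus (Fin d))) := by
  refine ⟨measurable_pi_lambda _ fun s => hP.measurable_points _, ?_⟩
  have h := (iIndepFun_iff_map_fun_eq_pi_map
    fun s => (hP.measurable_points (e s)).aemeasurable).1 (hP.indep_points.precomp he)
  refine h.trans ?_
  simp only [hP.uniform]
  rfl

open Classical in
theorem IsPoissonSample.lintegral_tupleTerm (hP : IsPoissonSample μ n X N) (r : ℝ) {m : ℕ}
    (j : Fin (k + 1) ↪ Fin m) :
    ∫⁻ ω, tupleTerm r (fun a => X (j a) ω) (fun i : {i // i ∉ Set.range j} => X i ω) ∂μ =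
      tupleProb d k r m := by
  let e : Fin (k + 1) ⊕ {i // i ∉ Set.range j} → ℕ := Sum.elim (fun a => j a) fun i => i
  have he : Function.Injective e := by
    have h1 : Function.Injective fun a => ((j a : Fin m) : ℕ) :=
      Fin.val_injective.comp j.injective
    have h2 : Function.Injective fun i : {i // i ∉ Set.range j} => ((i : Fin m) : ℕ) :=
      Fin.val_injective.comp Subtype.val_injective
    refine h1.sumElim h2 fun a i h => i.2 ⟨a, Fin.val_injective h⟩
  have h := (volume_measurePreserving_sumPiEquivProdPi fun _ => UnitAddTorus (Fin d)).comp
    (hP.measurePreserving he)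
  rw [← TorusPoisson.lintegral_tupleTerm r j, ← h.lintegral_comp (measurable_tupleTerm r measurable_fst measurable_snd)]
  rfl

/-- Points of the torus are null when `d > 0`, hence so is the diagonal, and there are countably
many pairs of indices. -/
theorem IsPoissonSample.ae_ne (hP : IsPoissonSample μ n X N) (hd : 0 < d) :
    ∀ᵐ ω ∂μ, Function.Injective fun i => X i ω := by
  have h : ∀ i j : ℕ, i ≠ j → ∀ᵐ ω ∂μ, X i ω ≠ X j ω := by
    intro i j hij
    have hdiag : MeasurableSet {q : UnitAddTorus (Fin d) × UnitAddTorus (Fin d) | q.1 = q.2} :=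
      isClosed_diagonal.measurableSet
    have h0 : (volume : Measure (UnitAddTorus (Fin d) × UnitAddTorus (Fin d)))
        {q | q.1 = q.2} = 0 := by
      rw [Measure.volume_eq_prod, Measure.measure_prod_null hdiag]
      refine Eventually.of_forall fun x => ?_
      have := nullSingletonClass_unitAddTorus hd
      have e : Prod.mk x ⁻¹' {q : UnitAddTorus (Fin d) × UnitAddTorus (Fin d) | q.1 = q.2} = {x} := by
        ext y
        simp [eq_comm]
      change volume (Prod.mk x ⁻¹' _) = 0
      rw [e]
      exact measure_singleton x
    have hmap := (indepFun_iff_map_prod_eq_prod_map_map (hP.measurable_points i).aemeasurable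
      (hP.measurable_points j).aemeasurable).1 (hP.indep_points.indepFun hij)
    rw [hP.uniform, hP.uniform, ← Measure.volume_eq_prod] at hmap
    rw [← hmap, Measure.map_apply ((hP.measurable_points i).prodMk (hP.measurable_points j))
      hdiag] at h0
    rw [ae_iff]
    simpa using h0
  have h2 : ∀ᵐ ω ∂μ, ∀ i j : ℕ, i ≠ j → X i ω ≠ X j ω := by
    simp_rw [ae_all_iff]
    exact h
  filter_upwards [h2] with ω hω i j hij
  by_contra hne
  exact hω i j hne hij

theorem IsPoissonSample.lintegral_tupleCount (hP : IsPoissonSample μ n X N) (r : ℝ) (m : ℕ) :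
    ∫⁻ ω, tupleCount k r m (fun i => X i ω) ∂μ =
      m.descFactorial (k + 1) * tupleProb d k r m := by
  classical
  unfold tupleCount
  rw [lintegral_finsetSum]
  · simp_rw [hP.lintegral_tupleTerm]
    rw [Finset.sum_const, Finset.card_univ, Fintype.card_embedding_eq, Fintype.card_fin,
      Fintype.card_fin, nsmul_eq_mul]
  · intro j _
    exact measurable_tupleTerm r (measurable_pi_lambda _ fun _ => hP.measurable_points _)
      (measurable_pi_lambda _ fun _ => hP.measurable_points _)

theorem IsPoissonSample.ae_remainingCount_eq (hP : IsPoissonSample μ n X N) (hk : 1 ≤ k)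
    (hd : 0 < d) (r : ℝ) :
    ∀ᵐ ω ∂μ, ((k + 1).factorial : ENNReal) * remainingCount (pointSet X N ω) k r =
      poissonTupleCount k r X N ω := by
  classical
  filter_upwards [hP.ae_ne hd] with ω hω
  have hinj : Function.Injective fun i : Fin (N ω) => X i ω := hω.comp Fin.val_injective
  rw [← Nat.cast_mul, ← ncard_criticalTuples hk (finite_pointSet X N ω), pointSet_eq_range,
    ncard_criticalTuples_range hk hinj, poissonTupleCount,
    tsum_eq_single (N ω)]
  · rw [Set.indicator_of_mem (Set.mem_singleton _), Pi.one_apply, one_mul]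
    rfl
  · intro m hm
    rw [Set.indicator_of_notMem (by simpa using hm.symm), zero_mul]

/-- Splitting over the value `m` of `N` makes each term a product of a function of `N` and a
function of the points, which are independent. -/
theorem IsPoissonSample.lintegral_poissonTupleCount (hP : IsPoissonSample μ n X N) (r : ℝ) :
    ∫⁻ ω, poissonTupleCount k r X N ω ∂μ =
      ∑' m : ℕ, ENNReal.ofReal (Real.exp (-n) * (n : ℝ) ^ m / m.factorial) *
        (m.descFactorial (k + 1) * tupleProb d k r m) := by
  unfold poissonTupleCount
  have hm : ∀ m : ℕ, AEMeasurable (fun ω => (({m} : Set ℕ).indicator 1 (N ω)) *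
      tupleCount k r m fun i => X i ω) μ := fun m =>
    ((hP.measurable_indicator_count m).mul
      ((measurable_tupleCount r m).comp hP.measurable_points')).aemeasurable
  rw [lintegral_tsum hm]
  refine tsum_congr fun m => ?_
  have hind : IndepFun (fun ω => (({m} : Set ℕ).indicator 1 (N ω) : ENNReal))
      (fun ω => tupleCount k r m fun i => X i ω) μ :=
    hP.indep_count.symm.comp (measurable_one.indicator (measurableSet_singleton m))
      (measurable_tupleCount r m)
  have h := lintegral_mul_eq_lintegral_mul_lintegral_of_indepFun
    (hP.measurable_indicator_count m)
    ((measurable_tupleCount (k := k) r m).comp hP.measurable_points') hind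
  simp only [Pi.mul_apply, Function.comp_apply] at h
  rw [h, hP.lintegral_tupleCount]
  congr 1
  rw [← lintegral_map (f := ({m} : Set ℕ).indicator 1)
    (measurable_one.indicator (measurableSet_singleton m)) hP.measurable_count, hP.poisson,
    lintegral_indicator_one (measurableSet_singleton m), poissonMeasure_singleton]

end Sample

/-- This is the `k`-th derivative in `q` of the Poisson generating function `exp (-n (1 - q))`. The
terms with `m < k` vanish, and shifting by `k` leaves an exponential series. -/
theorem tsum_poisson_mul_descFactorial (n : ℝ≥0) (k : ℕ) {q : ℝ} (hq : 0 ≤ q) :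
    ∑' m : ℕ, ENNReal.ofReal (Real.exp (-n) * (n : ℝ) ^ m / m.factorial) *
      (m.descFactorial k * ENNReal.ofReal q ^ (m - k)) =
      ENNReal.ofReal ((n : ℝ) ^ k * Real.exp (-(n * (1 - q)))) := by
  have hterm : ∀ m : ℕ, ENNReal.ofReal (Real.exp (-n) * (n : ℝ) ^ m / m.factorial) *
      (m.descFactorial k * ENNReal.ofReal q ^ (m - k)) =
      ENNReal.ofReal (Real.exp (-n) * (n : ℝ) ^ m / m.factorial *
        (m.descFactorial k * q ^ (m - k))) := by
    intro m
    rw [ENNReal.ofReal_mul (by positivity), ENNReal.ofReal_mul (by positivity),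
      ENNReal.ofReal_pow hq, ENNReal.ofReal_natCast]
  simp_rw [hterm]
  have hs : HasSum (fun m : ℕ => Real.exp (-n) * (n : ℝ) ^ m / m.factorial *
      (m.descFactorial k * q ^ (m - k))) ((n : ℝ) ^ k * Real.exp (-(n * (1 - q)))) := by
    rw [← hasSum_nat_add_iff' k, Finset.sum_eq_zero, sub_zero]
    · have h := (NormedSpace.expSeries_div_hasSum_exp ((n : ℝ) * q)).mul_left
        (Real.exp (-n) * (n : ℝ) ^ k)
      rw [← Real.exp_eq_exp_ℝ] at h
      convert! h using 1
      · funext m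
        have h1 : ((m + k).factorial : ℝ) = m.factorial * (m + k).descFactorial k := by
          rw [← Nat.cast_mul, ← Nat.factorial_mul_descFactorial (Nat.le_add_left k m),
            Nat.add_sub_cancel]
        have h2 : ((m + k).descFactorial k : ℝ) ≠ 0 := by
          have := Nat.descFactorial_pos.2 (Nat.le_add_left k m)
          positivity
        rw [h1, Nat.add_sub_cancel, pow_add, mul_pow]
        field_simp
      · rw [mul_right_comm, ← Real.exp_add, mul_comm]
        congr 2
        ring
    · intro m hm
      rw [Nat.descFactorial_eq_zero_iff_lt.2 (Finset.mem_range.1 hm)]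
      simp
  rw [← ENNReal.ofReal_tsum_of_nonneg (fun m => by positivity) hs.summable, hs.tsum_eq]

/-! ### Reduction of the expectation to a one-dimensional integral. -/

section Expectation

variable {d k : ℕ}

theorem IsAdmissible.circumVolume_le_one {r : ℝ} {x : Fin (k + 1) → UnitAddTorus (Fin d)}
    (hx : IsAdmissible r x) : circumVolume (edgeVectors x) ≤ 1 :=
  ballVolume_mul_pow_le_one 0 (norm_nonneg _) hx.tupleRadius_lt

theorem tsum_poisson_mul_tupleProb (n : ℝ≥0) (r : ℝ) :
    ∑' m : ℕ, ENNReal.ofReal (Real.exp (-n) * (n : ℝ) ^ m / m.factorial) *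
      (m.descFactorial (k + 1) * tupleProb d k r m) =
    ∫⁻ x in {x : Fin (k + 1) → UnitAddTorus (Fin d) | IsAdmissible r x},
      ENNReal.ofReal ((n : ℝ) ^ (k + 1) * Real.exp (-(n * circumVolume (edgeVectors x)))) := by
  have hv : Measurable fun x : Fin (k + 1) → UnitAddTorus (Fin d) =>
      circumVolume (edgeVectors x) := measurable_circumVolume.comp measurable_edgeVectors
  have hm : ∀ m : ℕ, Measurable fun x : Fin (k + 1) → UnitAddTorus (Fin d) =>
      ENNReal.ofReal (1 - circumVolume (edgeVectors x)) ^ (m - (k + 1)) := fun m =>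
    ((measurable_const.sub hv).ennreal_ofReal).pow_const _
  simp_rw [tupleProb, ← lintegral_const_mul _ (hm _), ← lintegral_const_mul _
    (Measurable.const_mul (hm _) _)]
  rw [← lintegral_tsum fun m => ((Measurable.const_mul (hm m) _).const_mul _).aemeasurable]
  refine setLIntegral_congr_fun (measurableSet_isAdmissible r) fun x hx => ?_
  have h := tsum_poisson_mul_descFactorial n (k + 1)
    (sub_nonneg.2 (IsAdmissible.circumVolume_le_one hx))
  rw [sub_sub_cancel] at h
  exact h

/-- The bounds on the radius are bounds on the volume of the circumball. Once the base point is
removed by translation, the integrand depends on that volume alone and `map_circumVolume` applies.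
-/
theorem setLIntegral_isAdmissible (hk : 1 ≤ k) (hd : 0 < d) {g : ℝ → ENNReal} (hg : Measurable g)
    {r : ℝ} (hr : 0 ≤ r) :
    ∫⁻ x in {x : Fin (k + 1) → UnitAddTorus (Fin d) | IsAdmissible r x},
      g (circumVolume (edgeVectors x)) =
    ∫⁻ s in Set.Ioc (ballVolume d * r ^ d) (ballVolume d * rMax ^ d), ENNReal.ofReal
      (volume.real (centredTuples d k) / ballVolume d ^ k * (k * s ^ (k - 1))) * g s := by
  set α := ballVolume d * r ^ d
  set β := ballVolume d * rMax ^ d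
  have hmax : 0 ≤ rMax := by norm_num [rMax, rConv]
  let S : Set (Fin k → EuclideanSpace ℝ (Fin d)) := {z | IsCentred z ∧ r < ‖centre z‖ ∧
    ‖centre z‖ ≤ rMax}
  have hS : S = {z | IsCentred z} ∩ circumVolume ⁻¹' Set.Ioc α β := by
    ext z
    simp only [S, Set.mem_inter_iff, Set.mem_ofPred_eq, Set.mem_preimage, Set.mem_Ioc]
    rw [circumVolume_le_iff hd z hmax, ← not_le (a := circumVolume z), circumVolume_le_iff hd z hr,
      not_le]
  have hSm : MeasurableSet S := by
    rw [hS]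
    exact measurableSet_isCentred.inter (measurable_circumVolume measurableSet_Ioc)
  have hgv : Measurable fun z : Fin k → EuclideanSpace ℝ (Fin d) => g (circumVolume z) :=
    hg.comp measurable_circumVolume
  have hnonneg : 0 ≤ α := mul_nonneg (ballVolume_pos d).le (pow_nonneg hr d)
  rw [← lintegral_indicator (measurableSet_isAdmissible r)]
  have e1 : ∀ x : Fin (k + 1) → UnitAddTorus (Fin d),
      {x | IsAdmissible r x}.indicator (fun x => g (circumVolume (edgeVectors x))) x =
      S.indicator (fun z => g (circumVolume z)) (fun i => lift (x i.succ - x 0)) := fun x => rfl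
  simp_rw [e1]
  rw [lintegral_lift_sub _ (hgv.indicator hSm)]
  · rw [lintegral_indicator hSm, hS, Set.inter_comm, ← Measure.restrict_restrict
      (measurable_circumVolume measurableSet_Ioc), ← lintegral_indicator
      (measurable_circumVolume measurableSet_Ioc)]
    change ∫⁻ z in _, (Set.Ioc α β).indicator g (circumVolume z) = _
    rw [lintegral_comp_circumVolume hk hd (hg.indicator measurableSet_Ioc)]
    refine (lintegral_congr fun s => (Set.indicator_mul_right _ (fun s => ENNReal.ofReal
      (volume.real (centredTuples d k) / ballVolume d ^ k * (k * s ^ (k - 1)))) g).symm).trans ?_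
    rw [lintegral_indicator measurableSet_Ioc, Measure.restrict_restrict measurableSet_Ioc,
      Set.inter_eq_left.2]
    exact fun s hs => hnonneg.trans_lt hs.1
  · intro z hz i
    have hzS : z ∈ S := by
      by_contra h
      exact hz (Set.indicator_of_notMem h _)
    have h1 := hzS.1.norm_le i
    have h2 := hzS.2.2
    norm_num [rMax, rConv] at h2
    linarith

end Expectation

/-! ### The upper incomplete Gamma function -/

section UpperGamma

/-- The upper incomplete Gamma function `Γ(m + 1, u) = ∫_u^∞ s^m e^{-s} ds`. -/
def upperGamma : ℕ → ℝ → ℝ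
  | 0, u => Real.exp (-u)
  | m + 1, u => u ^ (m + 1) * Real.exp (-u) + (m + 1) * upperGamma m u

/-- The derivative of the power `u ^ (m + 1)` cancels against the recursive term. This makes the
recursion a primitive, so no improper integral is needed. -/
theorem hasDerivAt_upperGamma (m : ℕ) (u : ℝ) :
    HasDerivAt (upperGamma m) (-(u ^ m * Real.exp (-u))) u := by
  have hexp : HasDerivAt (fun u : ℝ => Real.exp (-u)) (-Real.exp (-u)) u := by
    simpa using (hasDerivAt_neg u).exp
  induction m with
  | zero => simpa [upperGamma] using hexp
  | succ m ih =>
    have h := ((hasDerivAt_pow (m + 1) u).mul hexp).add (ih.const_mul ((m : ℝ) + 1))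
    convert! h using 1
    push_cast
    ring

theorem upperGamma_antitoneOn (m : ℕ) : AntitoneOn (upperGamma m) (Set.Ici 0) := by
  refine antitoneOn_of_deriv_nonpos (convex_Ici 0)
    (fun u _ => (hasDerivAt_upperGamma m u).continuousAt.continuousWithinAt)
    (fun u _ => (hasDerivAt_upperGamma m u).differentiableAt.differentiableWithinAt) fun u hu => ?_
  rw [interior_Ici, Set.mem_Ioi] at hu
  rw [(hasDerivAt_upperGamma m u).deriv, neg_nonpos]
  positivity

theorem integral_pow_mul_exp_neg_mul (m : ℕ) (c a b : ℝ) :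
    ∫ s in a..b, c * ((c * s) ^ m * Real.exp (-(c * s))) =
      upperGamma m (c * a) - upperGamma m (c * b) := by
  have h : ∀ s ∈ Set.uIcc a b, HasDerivAt (fun s => -upperGamma m (c * s))
      (c * ((c * s) ^ m * Real.exp (-(c * s)))) s := by
    intro s _
    have h := ((hasDerivAt_upperGamma m (c * s)).comp s
      ((hasDerivAt_id s).const_mul c)).neg
    convert! h using 1
    simp
    ring
  rw [intervalIntegral.integral_eq_sub_of_hasDerivAt h
    (Continuous.intervalIntegrable (by fun_prop) _ _)]
  ring

/-- Dividing the recursion by its leading term gives `1 + (m + 1) u⁻¹` times the previous ratio. -/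
theorem tendsto_upperGamma_div (m : ℕ) :
    Tendsto (fun u => upperGamma m u / (u ^ m * Real.exp (-u))) atTop (𝓝 1) := by
  induction m with
  | zero => simp [upperGamma, (Real.exp_pos _).ne']
  | succ m ih =>
    have h : Tendsto (fun u : ℝ => 1 + ((m : ℝ) + 1) *
        (upperGamma m u / (u ^ m * Real.exp (-u))) * u⁻¹) atTop (𝓝 1) := by
      simpa using ((ih.const_mul ((m : ℝ) + 1)).mul tendsto_inv_atTop_zero).const_add 1
    refine h.congr' ?_
    filter_upwards [eventually_gt_atTop 0] with u hu
    have := (Real.exp_pos (-u)).ne'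
    rw [upperGamma, add_div, div_self (by positivity), pow_succ]
    field_simp

variable {ι : Type*} {l : Filter ι} {n : ι → ℝ}

theorem tendsto_log_log_div_log :
    Tendsto (fun x : ℝ => Real.log (Real.log x) / Real.log x) atTop (𝓝 0) :=
  (Real.isLittleO_log_id_atTop.tendsto_div_nhds_zero).comp Real.tendsto_log_atTop

/-- The asymptotics of the upper incomplete Gamma function at the threshold
`log n + m log log n + w`. -/
theorem tendsto_mul_upperGamma (m : ℕ) (hn : Tendsto n l atTop) {w : ι → ℝ} {a : ℝ}
    (hw : Tendsto w l (𝓝 a)) :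
    Tendsto (fun i => Real.log (n i) + m * Real.log (Real.log (n i)) + w i) l atTop ∧
    Tendsto (fun i => n i * upperGamma m
      (Real.log (n i) + m * Real.log (Real.log (n i)) + w i)) l (𝓝 (Real.exp (-a))) := by
  set L : ι → ℝ := fun i => Real.log (n i) + m * Real.log (Real.log (n i)) + w i with hL
  have hlog : Tendsto (fun i => Real.log (n i)) l atTop := Real.tendsto_log_atTop.comp hn
  have hratio : Tendsto (fun i => L i / Real.log (n i)) l (𝓝 1) := by
    have h1 : Tendsto (fun i => 1 + m * (Real.log (Real.log (n i)) / Real.log (n i)) +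
        w i * (Real.log (n i))⁻¹) l (𝓝 1) := by
      simpa using (((tendsto_log_log_div_log.comp hn).const_mul (m : ℝ)).const_add 1).add
        (hw.mul (tendsto_inv_atTop_zero.comp hlog))
    refine h1.congr' ?_
    filter_upwards [hlog.eventually_gt_atTop 0] with i hi
    simp only [hL]
    field_simp
  have hLtop : Tendsto L l atTop := by
    have h1 := hratio.pos_mul_atTop one_pos hlog
    refine h1.congr' ?_
    filter_upwards [hlog.eventually_gt_atTop 0] with i hi
    field_simp
  refine ⟨hLtop, ?_⟩
  have h2 : Tendsto (fun i => upperGamma m (L i) / (L i ^ m * Real.exp (-L i)) *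
      ((L i / Real.log (n i)) ^ m * Real.exp (-w i))) l (𝓝 (Real.exp (-a))) := by
    simpa using ((tendsto_upperGamma_div m).comp hLtop).mul
      ((hratio.pow m).mul ((Real.continuous_exp.tendsto _).comp hw.neg))
  refine h2.congr' ?_
  filter_upwards [hlog.eventually_gt_atTop 0, hLtop.eventually_gt_atTop 0,
    hn.eventually_gt_atTop 0] with i h1 h3 h4
  -- The `log log` term of the threshold is chosen for this factor `(log n) ^ (-m)`, which cancels
  -- `L ^ m ~ (log n) ^ m`.
  have hexp : Real.exp (-L i) = (n i)⁻¹ * (Real.log (n i) ^ m)⁻¹ * Real.exp (-w i) := by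
    have : -L i = -Real.log (n i) + -(m * Real.log (Real.log (n i))) + -w i := by
      simp only [hL]; ring
    rw [this, Real.exp_add, Real.exp_add, Real.exp_neg, Real.exp_neg, Real.exp_log h4,
      ← Real.log_pow, Real.exp_log (pow_pos h1 m)]
  have := (Real.exp_pos (-w i)).ne'
  change _ = n i * upperGamma m (L i)
  rw [hexp, div_pow]
  field_simp

theorem tendsto_mul_upperGamma_mul (m : ℕ) (hn : Tendsto n l atTop) {b : ℝ} (hb : 0 < b) :
    Tendsto (fun i => n i * upperGamma m (n i * b)) l (𝓝 0) := by
  have hnb : Tendsto (fun i => n i * b) l atTop := hn.atTop_mul_const hb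
  have h1 : Tendsto (fun i => b⁻¹ * (upperGamma m (n i * b) / ((n i * b) ^ m *
      Real.exp (-(n i * b)))) * ((n i * b) ^ (m + 1) * Real.exp (-(n i * b)))) l (𝓝 0) := by
    simpa using (((tendsto_upperGamma_div m).comp hnb).const_mul b⁻¹).mul
      ((Real.tendsto_pow_mul_exp_neg_atTop_nhds_zero (m + 1)).comp hnb)
  refine h1.congr' ?_
  filter_upwards [hn.eventually_gt_atTop 0] with i hi
  have := (Real.exp_pos (-(n i * b))).ne'
  field_simp
  ring

end UpperGamma

/-! ### The closed formula and the limit -/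

section Formula

variable {d k : ℕ}

/-- The right-hand side is the constant of the density of `V`, divided by the `(k + 1)!` orderings.
-/
theorem constD_div_factorial (hk : 1 ≤ k) (hd : 0 < d) : constD d k / (k - 1).factorial =
    volume.real (centredTuples d k) / ballVolume d ^ k * k / (k + 1).factorial := by
  have hω := ballVolume_pos d
  have h1 : ((k - 1).factorial : ℝ) ≠ 0 := by positivity
  have h2 : (d : ℝ) ≠ 0 := by positivity
  rw [constD, constDTilde]
  field_simp

theorem constD_div_factorial_pos (hk : 1 ≤ k) (hkd : k ≤ d) :
    0 < constD d k / (k - 1).factorial := by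
  have hω := ballVolume_pos d
  have := volume_centredTuples_pos hk hkd
  rw [constD_div_factorial hk (by omega)]
  have : (0 : ℝ) < k := by exact_mod_cast hk
  positivity

theorem lintegral_density (hk : 1 ≤ k) {A a b : ℝ} (n : ℝ≥0) (hA : 0 ≤ A) (ha : 0 ≤ a)
    (hb : 0 ≤ b) :
    ∫⁻ s in Set.Ioc a b, ENNReal.ofReal (A * (k * s ^ (k - 1))) *
        ENNReal.ofReal ((n : ℝ) ^ (k + 1) * Real.exp (-(n * s))) =
      ENNReal.ofReal (A * k * (n * (upperGamma (k - 1) (n * a) - upperGamma (k - 1) (n * b)))) := by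
  rcases le_or_gt a b with hab | hab
  · rw [← integral_pow_mul_exp_neg_mul, ← intervalIntegral.integral_const_mul,
      ← intervalIntegral.integral_const_mul, intervalIntegral.integral_of_le hab,
      ofReal_integral_eq_lintegral_ofReal]
    · refine setLIntegral_congr_fun measurableSet_Ioc fun s hs => ?_
      have : 0 ≤ s := ha.trans hs.1.le
      rw [← ENNReal.ofReal_mul (by positivity)]
      congr 1
      obtain ⟨m, rfl⟩ : ∃ m, k = m + 1 := ⟨k - 1, by omega⟩
      simp only [Nat.add_sub_cancel]
      ring
    · exact Continuous.integrableOn_Ioc (by fun_prop)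
    · refine (ae_restrict_iff' measurableSet_Ioc).2 (Eventually.of_forall fun s hs => ?_)
      have : 0 ≤ s := ha.trans hs.1.le
      simp only [Pi.zero_apply]
      positivity
  -- When `r > r_max` the interval is empty and the Gamma difference is nonpositive, so
  -- `ENNReal.ofReal` sends it to `0`. The formula thus needs no upper bound on `r`.
  · rw [Set.Ioc_eq_empty hab.not_gt, Measure.restrict_empty, lintegral_zero_measure, eq_comm,
      ENNReal.ofReal_eq_zero]
    have h := upperGamma_antitoneOn (k - 1) (a := n * b) (b := n * a)
      (by simp only [Set.mem_Ici]; positivity) (by simp only [Set.mem_Ici]; positivity)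
      (mul_le_mul_of_nonneg_left hab.le n.2)
    exact mul_nonpos_of_nonneg_of_nonpos (by positivity)
      (mul_nonpos_of_nonneg_of_nonpos n.2 (sub_nonpos.2 h))

variable {Ω : Type*} [MeasurableSpace Ω] {μ : Measure Ω} [IsProbabilityMeasure μ]
  {n : ℝ≥0} {X : ℕ → Ω → UnitAddTorus (Fin d)} {N : Ω → ℕ}

theorem IsPoissonSample.lintegral_poissonTupleCount_eq (hP : IsPoissonSample μ n X N)
    (hk : 1 ≤ k) (hd : 0 < d) {r : ℝ} (hr : 0 ≤ r) :
    ∫⁻ ω, poissonTupleCount k r X N ω ∂μ = ENNReal.ofReal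
      (volume.real (centredTuples d k) / ballVolume d ^ k * k *
        (n * (upperGamma (k - 1) (n * (ballVolume d * r ^ d)) -
          upperGamma (k - 1) (n * (ballVolume d * rMax ^ d))))) := by
  have hω := ballVolume_pos d
  have hmax : 0 ≤ rMax := by norm_num [rMax, rConv]
  rw [hP.lintegral_poissonTupleCount, tsum_poisson_mul_tupleProb,
    setLIntegral_isAdmissible hk hd (g := fun s => ENNReal.ofReal
      ((n : ℝ) ^ (k + 1) * Real.exp (-(n * s)))) (by fun_prop) hr]
  exact lintegral_density hk n (by positivity) (by positivity) (by positivity)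

theorem IsPoissonSample.ae_remainingCount_eq_toReal (hP : IsPoissonSample μ n X N)
    (hk : 1 ≤ k) (hd : 0 < d) (r : ℝ) :
    (fun ω => (remainingCount (pointSet X N ω) k r : ℝ)) =ᵐ[μ]
      fun ω => (poissonTupleCount k r X N ω).toReal / (k + 1).factorial := by
  filter_upwards [hP.ae_remainingCount_eq hk hd r] with ω hω
  have h : ((k + 1).factorial : ℝ) ≠ 0 := by positivity
  rw [← hω, ENNReal.toReal_mul, ENNReal.toReal_natCast, ENNReal.toReal_natCast,
    mul_div_cancel_left₀ _ h]

theorem IsPoissonSample.integrable_remainingCount (hP : IsPoissonSample μ n X N)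
    (hk : 1 ≤ k) (hd : 0 < d) {r : ℝ} (hr : 0 ≤ r) :
    Integrable (fun ω => (remainingCount (pointSet X N ω) k r : ℝ)) μ := by
  refine (Integrable.congr ?_ (hP.ae_remainingCount_eq_toReal hk hd r).symm)
  refine (integrable_toReal_of_lintegral_ne_top
    (hP.measurable_poissonTupleCount r).aemeasurable ?_).div_const _
  rw [hP.lintegral_poissonTupleCount_eq hk hd hr]
  exact ENNReal.ofReal_ne_top

/-- The expected number of critical points of index `k` with value in `(r, r_max]`. -/
theorem IsPoissonSample.integral_remainingCount (hP : IsPoissonSample μ n X N)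
    (hk : 1 ≤ k) (hd : 0 < d) {r : ℝ} (hr : 0 ≤ r) :
    ∫ ω, (remainingCount (pointSet X N ω) k r : ℝ) ∂μ =
      max (constD d k / (k - 1).factorial *
        (n * upperGamma (k - 1) (ballVolume d * n * r ^ d) -
          n * upperGamma (k - 1) (n * (ballVolume d * rMax ^ d)))) 0 := by
  rw [integral_congr_ae (hP.ae_remainingCount_eq_toReal hk hd r), integral_div,
    integral_toReal (hP.measurable_poissonTupleCount r).aemeasurable,
    hP.lintegral_poissonTupleCount_eq hk hd hr, ENNReal.toReal_ofReal', constD_div_factorial hk hd]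
  · rw [max_div_div_right (by positivity) _ (0 : ℝ) |>.symm, zero_div]
    congr 1
    rw [mul_assoc (ballVolume d), mul_left_comm (ballVolume d), ← mul_sub]
    ring
  · refine ae_lt_top (hP.measurable_poissonTupleCount r) ?_
    rw [hP.lintegral_poissonTupleCount_eq hk hd hr]
    exact ENNReal.ofReal_ne_top

end Formula

end TorusPoisson

end

theorem corollary6p3 {d k : ℕ} (hk : 1 ≤ k) (hkd : k ≤ d)
    {ι : Type*} {l : Filter ι} (n : ι → ℝ≥0) (hn : Tendsto n l atTop)
    {Ω : ι → Type*} [∀ i, MeasurableSpace (Ω i)] (μ : ∀ i, Measure (Ω i))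
    [∀ i, IsProbabilityMeasure (μ i)]
    (X : ∀ i, ℕ → Ω i → UnitAddTorus (Fin d)) (N : ∀ i, Ω i → ℕ)
    (hP : ∀ i, TorusPoisson.IsPoissonSample (μ i) (n i) (X i) (N i))
    (r w : ι → ℝ) (hr : ∀ i, 0 ≤ r i)
    (hΛ : ∀ᶠ i in l, TorusPoisson.ballVolume d * n i * r i ^ d
      = Real.log (n i) + ((k : ℝ) - 1) * Real.log (Real.log (n i)) + w i) :
    (∀ i ω, (TorusPoisson.remainingCriticalPoints
      (TorusPoisson.pointSet (X i) (N i) ω) k (r i)).Finite) ∧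
    (∀ i, Integrable (fun ω => (TorusPoisson.remainingCount
      (TorusPoisson.pointSet (X i) (N i) ω) k (r i) : ℝ)) (μ i)) ∧
    (Tendsto w l atBot →
      Tendsto (fun i => ∫ ω, (TorusPoisson.remainingCount
        (TorusPoisson.pointSet (X i) (N i) ω) k (r i) : ℝ) ∂(μ i)) l atTop) ∧
    (∀ a : ℝ, Tendsto w l (𝓝 a) →
      Tendsto (fun i => ∫ ω, (TorusPoisson.remainingCount
        (TorusPoisson.pointSet (X i) (N i) ω) k (r i) : ℝ) ∂(μ i)) l
        (𝓝 (TorusPoisson.constD d k / (k - 1).factorial * Real.exp (-a)))) ∧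
    (Tendsto w l atTop →
      Tendsto (fun i => ∫ ω, (TorusPoisson.remainingCount
        (TorusPoisson.pointSet (X i) (N i) ω) k (r i) : ℝ) ∂(μ i)) l (𝓝 0)) := by
  open TorusPoisson in
  have hd : 0 < d := by omega
  have hω := ballVolume_pos d
  have hn' : Tendsto (fun i => (n i : ℝ)) l atTop := NNReal.tendsto_coe_atTop.2 hn
  have hK := constD_div_factorial_pos hk hkd
  set K := constD d k / (k - 1).factorial
  have hmax : 0 < rMax := by norm_num [rMax, rConv]
  have htail : Tendsto (fun i => n i * upperGamma (k - 1) (n i * (ballVolume d * rMax ^ d))) l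
      (𝓝 0) := tendsto_mul_upperGamma_mul (k - 1) hn' (by positivity)
  -- The formula for the expectation, as a function of `w`.
  let F : ι → ℝ → ℝ := fun i w => max (K * (n i * upperGamma (k - 1)
    (Real.log (n i) + ((k - 1 : ℕ) : ℝ) * Real.log (Real.log (n i)) + w) -
      n i * upperGamma (k - 1) (n i * (ballVolume d * rMax ^ d)))) 0
  have hcast : ((k - 1 : ℕ) : ℝ) = (k : ℝ) - 1 := by
    rw [Nat.cast_sub hk, Nat.cast_one]
  have hF : ∀ᶠ i in l, ∫ ω, (remainingCount (pointSet (X i) (N i) ω) k (r i) : ℝ) ∂(μ i) =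
      F i (w i) := by
    filter_upwards [hΛ] with i hi
    rw [(hP i).integral_remainingCount hk hd (hr i), hi]
    simp only [F, hcast]
    rfl
  have hlim : ∀ (v : ι → ℝ) (a : ℝ), Tendsto v l (𝓝 a) →
      Tendsto (fun i => F i (v i)) l (𝓝 (K * Real.exp (-a))) := by
    intro v a hv
    have h := (((tendsto_mul_upperGamma (k - 1) hn' hv).2.sub htail).const_mul K).max
      (tendsto_const_nhds (x := (0 : ℝ)))
    rwa [sub_zero, max_eq_left (by positivity)] at h
  -- `w` may diverge at any speed, so the infinite cases are compared with constant `w`.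
  -- Antitonicity of `upperGamma` holds only on `[0, ∞)`, hence the sign condition.
  have hmono : ∀ i (v v' : ℝ), v ≤ v' →
      0 ≤ Real.log (n i) + ((k - 1 : ℕ) : ℝ) * Real.log (Real.log (n i)) + v →
      F i v' ≤ F i v := by
    intro i v v' hv h0
    refine max_le_max_right 0 (mul_le_mul_of_nonneg_left (sub_le_sub_right
      (mul_le_mul_of_nonneg_left ?_ (n i).2) _) hK.le)
    exact upperGamma_antitoneOn (k - 1) h0 (by simp only [Set.mem_Ici]; linarith) (by linarith)
  have hwpos : ∀ᶠ i in l,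
      0 ≤ Real.log (n i) + ((k - 1 : ℕ) : ℝ) * Real.log (Real.log (n i)) + w i := by
    filter_upwards [hΛ] with i hi
    rw [hcast, ← hi]
    have := hr i
    positivity
  refine ⟨fun i ω => finite_remainingCriticalPoints hk (finite_pointSet _ _ _),
    fun i => (hP i).integrable_remainingCount hk hd (hr i), fun hw => ?_, fun a hw => ?_,
    fun hw => ?_⟩
  -- Eventually `w ≤ a`, so the expectation is at least its value at the constant `a`, whose limit
  -- `K exp (-a)` exceeds `C`.
  · refine tendsto_atTop.2 fun C => ?_
    obtain ⟨a, ha⟩ : ∃ a : ℝ, C < K * Real.exp (-a) := by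
      have h : Tendsto (fun a : ℝ => K * Real.exp (-a)) atBot atTop :=
        (Real.tendsto_exp_atTop.comp tendsto_neg_atBot_atTop).const_mul_atTop hK
      exact (h.eventually_gt_atTop C).exists
    filter_upwards [hF, hwpos, hw.eventually_le_atBot a,
      (hlim (fun _ => a) a tendsto_const_nhds).eventually_const_lt ha] with i h1 h2 h3 h4
    rw [h1]
    exact h4.le.trans (hmono i _ _ h3 h2)
  · exact (hlim w a hw).congr' (hF.mono fun i hi => hi.symm)
  · refine tendsto_order.2 ⟨fun b hb => ?_, fun b hb => ?_⟩
    · filter_upwards with i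
      exact hb.trans_le (integral_nonneg fun ω => Nat.cast_nonneg _)
    · obtain ⟨a, ha⟩ : ∃ a : ℝ, K * Real.exp (-a) < b := by
        have h : Tendsto (fun a : ℝ => K * Real.exp (-a)) atTop (𝓝 0) := by
          simpa using (Real.tendsto_exp_neg_atTop_nhds_zero).const_mul K
        exact (h.eventually_lt_const hb).exists
      -- Here the smaller threshold is the one built from the constant `a`, so its sign comes from
      -- its divergence and not from `Λ ≥ 0`.
      have hpos := (tendsto_mul_upperGamma (k - 1) hn' (tendsto_const_nhds (x := a))).1
      filter_upwards [hF, hpos.eventually_ge_atTop 0, hw.eventually_ge_atTop a,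
        (hlim (fun _ => a) a tendsto_const_nhds).eventually_lt_const ha] with i h1 h2 h3 h4
      rw [h1]
      exact (hmono i _ _ h3 h2).trans_lt h4
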